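/- Let $k\ge 2$. A sensor has a battery of size $k$. Energy arrives according to a Poisson process of rate $1$ with counting process $(N(t))_{t\ge 0}$, and every arrival refills the battery completely; every update costs one unit of energy and is received instantly. An online policy is a sequence of update times $0=s_0\le s_1\le s_2\le\cdots$, each a $[0,\infty]$-valued stopping time of a filtration $(\mathcal F_t)$ to which $N$ is adapted and such that $N(t)-N(s)$ is independent of $\mathcal F_s$ for $s\le t$ (for instance the filtration generated by $N$). The battery is full just before the initial update $s_0=0$, i.e. the battery level $\mathcal E_n$ just before the update $s_n$ satisfies $\mathcal E_0=k$ and $$\mathcal E_{n}=\min\{\mathcal E_{n-1}-1+k\,(N(s_n)-N(s_{n-1})),\,k\}\qquad(n\ge1)$$ (energy arriving exactly at time $s_n$ is available to the update at $s_n$). The policy is feasible if almost surely $\mathcal E_n\ge 1$ for all $n$, and uniformly bounded if $\sup_{n\ge1}\mathbb E[(s_n-s_{n-1})^2]<\infty$. With $n(t)=\#\{n\ge1: s_n\le t\}$ and $$r(t)=\tfrac12\sum_{n=1}^{n(t)}(s_n-s_{n-1})^2+\tfrac12\,(t-s_{n(t)})^2,$$ its long-term average age is $\limsup_{T\to\infty}\frac1T\mathbb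 E[r(T)]$. Let $l_0=0$, and for $i\ge1$ let $l_i$ be the time of the $i$-th update with index $n\ge1$ that makes the battery drop from $k$ to $k-1$; the $i$-th epoch is the time from $l_{i-1}$ to $l_i$, and $\tau_i$ is the time from $l_{i-1}$ to the first energy arrival after $l_{i-1}$. **Theorem.** There are constants $0\le x_{k-1}\le x_{k-2}\le\dots\le x_1<\infty$ and a measurable function $x_k:[0,\infty)\to[0,\infty)$ with $x_k(\tau)\ge\tau$, depending only on $k$, such that, for every such process $N$ and filtration, there is a uniformly bounded feasible online policy whose long-term average age is the minimum over all uniformly bounded feasible online policies and which is a renewal policy of the following form. 1. The sequence $\{l_i\}$ is a renewal process: $l_0=0$, and the epoch lengths $l_i-l_{i-1}$ are almost surely finite, not almost surely zero, and independent and identically distributed. 2. Almost surely, for every $i\ge1$: $\tau_i<\infty$ and $l_i-l_{i-1}=x_k(\tau_i)$; and for every $1\le j\le k-1$ the $i$-th epoch contains a $(k-j)$-th update before its final one (the one at $l_i$) if and only if $x_j\le\tau_i$, and this update is then sent at time $l_{i-1}+x_j$. -/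

import Mathlib

open MeasureTheory ProbabilityTheory Filter
open scoped NNReal ENNReal

universe u

namespace AgeOfInformation

variable {Ω : Type u} [MeasurableSpace Ω]

/-- `N` is a Poisson counting process of rate one with respect to the filtration `ℱ`
(`N t` is the number of energy arrivals in `(0, t]`): it is adapted, starts from `0`, has
nondecreasing right-continuous paths, and `N t - N s` is Poisson distributed with mean `t - s`
and independent of `ℱ s`. For the filtration generated by `N` this is the usual notion. -/
structure IsPoissonProcess (P : Measure Ω) (ℱ : Filtration ℝ≥0 ‹MeasurableSpace Ω›)
    (N : ℝ≥0 → Ω → ℕ) : Prop where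
  adapted : Adapted ℱ N
  zero : ∀ ω, N 0 ω = 0
  mono : ∀ ω, Monotone (fun t => N t ω)
  right_cont : ∀ ω t, ContinuousWithinAt (fun u => N u ω) (Set.Ici t) t
  law : ∀ s t, s ≤ t → HasLaw (fun ω => N t ω - N s ω) (poissonMeasure (t - s)) P
  indep : ∀ s t, s ≤ t →
    Indep (MeasurableSpace.comap (fun ω => N t ω - N s ω) ⊤) (ℱ s) P

/-- An online transmission policy: a nondecreasing sequence of update times `s 0 = 0 ≤ s 1 ≤ …`,
each of them a stopping time of the information `ℱ` (the value `∞` means "never"). -/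
structure IsOnlinePolicy (ℱ : Filtration ℝ≥0 ‹MeasurableSpace Ω›)
    (s : ℕ → Ω → ℝ≥0∞) : Prop where
  zero : ∀ ω, s 0 ω = 0
  mono : ∀ ω, Monotone (fun n => s n ω)
  stopping : ∀ n, IsStoppingTime ℱ (s n)

/-- The number of energy arrivals in `(a, b]`, for finite times `a ≤ b`. -/
noncomputable def arrivals (N : ℝ≥0 → Ω → ℕ) (a b : ℝ≥0∞) (ω : Ω) : ℕ :=
  N b.toNNReal ω - N a.toNNReal ω

/-- The battery level immediately before the `n`-th update, for a battery of size `k`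
that is full just before the initial update `s 0 = 0`; every update costs one unit, every
arrival brings `k` units, and the overflow is lost. -/
noncomputable def battery (k : ℕ) (N : ℝ≥0 → Ω → ℕ) (s : ℕ → Ω → ℝ≥0∞) : ℕ → Ω → ℤ
  | 0, _ => k
  | n + 1, ω => min (battery k N s n ω - 1 + k * arrivals N (s n ω) (s (n + 1) ω) ω) k

/-- Energy causality: almost surely, at least one unit is available for every update. -/
def IsFeasible (P : Measure Ω) (k : ℕ) (N : ℝ≥0 → Ω → ℕ) (s : ℕ → Ω → ℝ≥0∞) : Prop :=
  ∀ᵐ ω ∂P, ∀ n, 1 ≤ battery k N s n ω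

/-- The inter-update delays have uniformly bounded second moments. In particular all update times
are then almost surely finite. -/
def IsUniformlyBounded (P : Measure Ω) (s : ℕ → Ω → ℝ≥0∞) : Prop :=
  ∃ M : ℝ≥0, ∀ n, ∫⁻ ω, (s (n + 1) ω - s n ω) ^ 2 ∂P ≤ M

/-- The uniformly bounded feasible online policies. -/
structure IsAdmissible (P : Measure Ω) (ℱ : Filtration ℝ≥0 ‹MeasurableSpace Ω›)
    (k : ℕ) (N : ℝ≥0 → Ω → ℕ) (s : ℕ → Ω → ℝ≥0∞) : Prop where
  online : IsOnlinePolicy ℱ s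
  feasible : IsFeasible P k N s
  bounded : IsUniformlyBounded P s

/-- The number of updates (not counting the initial one at time `0`) sent by time `t`. -/
noncomputable def numUpdates (s : ℕ → Ω → ℝ≥0∞) (t : ℝ≥0) (ω : Ω) : ℕ :=
  {n : ℕ | 1 ≤ n ∧ s n ω ≤ t}.ncard

/-- The area under the age curve on `[0, t]`. -/
noncomputable def ageArea (s : ℕ → Ω → ℝ≥0∞) (t : ℝ≥0) (ω : Ω) : ℝ≥0∞ :=
  (∑ n ∈ Finset.range (numUpdates s t ω), (s (n + 1) ω - s n ω) ^ 2) / 2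
    + (t - s (numUpdates s t ω) ω) ^ 2 / 2

/-- The long term average age of information. -/
noncomputable def averageAge (P : Measure Ω) (s : ℕ → Ω → ℝ≥0∞) : ℝ≥0∞ :=
  limsup (fun T : ℝ≥0 => (∫⁻ ω, ageArea s T ω ∂P) / T) atTop

/-- `epochIndex k N s i ω` is the index of the `i`-th update (`i = 0, 1, …`) that finds the battery
full, that is, that makes the battery drop to level `k - 1`. The initial update has `i = 0`. -/
noncomputable def epochIndex (k : ℕ) (N : ℝ≥0 → Ω → ℕ) (s : ℕ → Ω → ℝ≥0∞) (i : ℕ) (ω : Ω) : ℕ :=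
  Nat.nth (fun n => battery k N s n ω = k) i

/-- The time at which the battery drops to `k - 1` for the `i`-th time (`0` for `i = 0`). -/
noncomputable def epochStart (k : ℕ) (N : ℝ≥0 → Ω → ℕ) (s : ℕ → Ω → ℝ≥0∞) (i : ℕ) (ω : Ω) : ℝ≥0∞ :=
  s (epochIndex k N s i ω) ω

/-- The time from `t` (finite) to the first energy arrival after `t`. -/
noncomputable def timeToArrival (N : ℝ≥0 → Ω → ℕ) (t : ℝ≥0∞) (ω : Ω) : ℝ≥0∞ :=
  ⨅ (v : ℝ≥0) (_ : N t.toNNReal ω < N (t.toNNReal + v) ω), (v : ℝ≥0∞)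

/-- `l` is a renewal process: it starts from `0`, and its increments are almost surely finite,
not almost surely zero, independent and identically distributed. -/
structure IsRenewalProcess (P : Measure Ω) (l : ℕ → Ω → ℝ≥0∞) : Prop where
  zero : ∀ᵐ ω ∂P, l 0 ω = 0
  mono : ∀ᵐ ω ∂P, Monotone (fun i => l i ω)
  finite : ∀ᵐ ω ∂P, ∀ i, l i ω ≠ ∞
  nontrivial : ¬ ∀ᵐ ω ∂P, l 1 ω - l 0 ω = 0
  indep : iIndepFun (fun i ω => l (i + 1) ω - l i ω) P
  ident : ∀ i, IdentDistrib (fun ω => l (i + 1) ω - l i ω) (fun ω => l 1 ω - l 0 ω) P P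

/-- Almost surely there are infinitely many epochs, and in each of them, with `l` its start,
`m` the index of the update sent at `l`, `m'` the index of the update that ends it and
`τ < ∞` the time from `l` to the next recharge:
* the epoch has length `g τ`;
* for `1 ≤ j ≤ k - 1`, the epoch has at least `k - j` updates before its final one exactly when
  `c j ≤ τ`, and then the `(k - j)`-th of them is sent at time `l + c j`. -/
def HasConstantOffsets (P : Measure Ω) (k : ℕ) (N : ℝ≥0 → Ω → ℕ) (s : ℕ → Ω → ℝ≥0∞)
    (c : ℕ → ℝ≥0) (g : ℝ≥0 → ℝ≥0) : Prop :=
  ∀ᵐ ω ∂P, {n : ℕ | battery k N s n ω = k}.Infinite ∧ ∀ i,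
    let l := epochStart k N s i ω
    let m := epochIndex k N s i ω
    let m' := epochIndex k N s (i + 1) ω
    let τ := timeToArrival N l ω
    τ ≠ ∞ ∧ epochStart k N s (i + 1) ω = l + g τ.toNNReal ∧
      ∀ j, 1 ≤ j → j ≤ k - 1 →
        (m + (k - j) < m' ↔ (c j : ℝ≥0∞) ≤ τ) ∧
        (m + (k - j) < m' → s (m + (k - j)) ω = l + c j)

end AgeOfInformation

/-! This is an average-cost control problem solved in closed form. For a trial rate `l`, charge a
delay `X` between updates the cost `X²/2 - l X = (X - l)²/2 - l²/2`; the optimal average age is the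
`l` at which the problem has value zero. Arrivals fill the battery and waiting times are memoryless,
so the state right after an update is the number `b` of units left, with relative value `h b =
relValue l b`.

If the next arrival comes at age `τ`, the best reaction is to update at age `max τ l`: this
minimises `(X - l)²/2` over `X ≥ τ`, and the battery is then full, so the next state is `k - 1`,
normalised to value zero. Never updating before the arrival therefore costs `exp (-l)`, the mean of
`((τ - l)⁺)²/2`. The option to update earlier, at `X = l + d`, replaces the mean remaining excess
`expectedExcess d` by `d²/2 + h (b - 1)`. For `h ≥ 0` one has `expectedExcess d ≤ d²/2 + h + exp
(-h) * exp d`, with equality at `d = h`. Since `exp t` times the indicator of no arrival by time `t`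
is a martingale, the last term has the same mean for every bounded stopping rule. Hence the best age
is `l + h (b - 1)`, and `h b = exp (-l) - exp (-l) * exp (-h (b - 1)) - l²/2`. By the intermediate
value theorem some `l > 0` makes `h (k - 1) = 0`, and then the other values are nonnegative
(`exists_isCriticalRate`).

Verification has two halves. For any admissible policy the pointwise inequality gives `l E[X] + h ≤
E[X²/2 + h']` for every delay (`lintegral_step_ge`), where `h'` is the value after the next update;
summing over the delays up to `T` gives `le_averageAge`. For the threshold policy the inequality is
reversed (`lintegral_step_le`), which gives `averageAge_thresholdPolicy_le`.

The renewal structure is read off the threshold policy. While nothing arrives, the updates of an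
epoch fall at the deterministic partial sums `offset`, so the epoch length is a function of the
first waiting time alone. By the strong Markov property these waiting times are independent and
exponential. -/

namespace AgeOfInformation

/-! ### Sample paths of the counting process and the waiting time for an arrival. -/

section Paths

variable {Ω : Type u} [mΩ : MeasurableSpace Ω] {P : Measure Ω} {ℱ : Filtration ℝ≥0 mΩ}
  {N : ℝ≥0 → Ω → ℕ}

theorem IsPoissonProcess.exists_gt_forall_eq (hN : IsPoissonProcess P ℱ N) (t : ℝ≥0) (ω : Ω) :
    ∃ r, t < r ∧ ∀ u, t ≤ u → u < r → N u ω = N t ω := by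
  have h := hN.right_cont ω t
  have h1 : ∀ᶠ u in nhdsWithin t (Set.Ici t), N u ω = N t ω := by
    have := h.tendsto (IsOpen.mem_nhds (isOpen_discrete {N t ω}) rfl)
    exact this
  obtain ⟨r, hr, hsub⟩ := (mem_nhdsGE_iff_exists_Ico_subset' (show t < t + 1 by simp)).1 h1
  exact ⟨r, hr, fun u h1 h2 => hsub ⟨h1, h2⟩⟩

theorem IsPoissonProcess.coe_lt_timeToArrival_iff (hN : IsPoissonProcess P ℱ N) (t : ℝ≥0∞)
    (v : ℝ≥0) (ω : Ω) :
    (v : ℝ≥0∞) < timeToArrival N t ω ↔ N (t.toNNReal + v) ω = N t.toNNReal ω := by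
  constructor
  · intro h
    by_contra hne
    have hlt : N t.toNNReal ω < N (t.toNNReal + v) ω :=
      lt_of_le_of_ne (hN.mono ω (by simp)) (Ne.symm hne)
    exact absurd (iInf₂_le v hlt : timeToArrival N t ω ≤ v) (not_le.2 h)
  · intro h
    obtain ⟨r, hr, hrN⟩ := hN.exists_gt_forall_eq (t.toNNReal + v) ω
    have hvr : v < r - t.toNNReal := lt_tsub_iff_left.2 hr
    refine lt_of_lt_of_le (ENNReal.coe_lt_coe.2 hvr) (le_iInf₂ fun w hw => ?_)
    rw [ENNReal.coe_le_coe]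
    by_contra! hlt
    have h3 : t.toNNReal + w < r := lt_tsub_iff_left.1 hlt
    rcases le_total w v with h4 | h4
    · have := hN.mono ω (show t.toNNReal + w ≤ t.toNNReal + v by gcongr)
      simp only at this
      omega
    · have := hrN _ (show t.toNNReal + v ≤ t.toNNReal + w by gcongr) h3
      omega

theorem IsPoissonProcess.timeToArrival_le_coe_iff (hN : IsPoissonProcess P ℱ N) (t : ℝ≥0∞)
    (v : ℝ≥0) (ω : Ω) :
    timeToArrival N t ω ≤ v ↔ N t.toNNReal ω < N (t.toNNReal + v) ω := by
  rw [← not_lt, hN.coe_lt_timeToArrival_iff]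
  have := hN.mono ω (show t.toNNReal ≤ t.toNNReal + v by simp)
  simp only at this
  omega

theorem IsPoissonProcess.timeToArrival_pos (hN : IsPoissonProcess P ℱ N) (t : ℝ≥0∞) (ω : Ω) :
    0 < timeToArrival N t ω := by
  simpa using (hN.coe_lt_timeToArrival_iff t 0 ω).2 (by simp)

/-- Without an arrival in `(t, t + x]`, the waiting time from `t` is `x` plus the waiting time
from `t + x`. -/
theorem IsPoissonProcess.timeToArrival_add (hN : IsPoissonProcess P ℱ N) (t x : ℝ≥0) (ω : Ω)
    (h : N (t + x) ω = N t ω) :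
    timeToArrival N t ω = x + timeToArrival N (t + x : ℝ≥0) ω := by
  refine le_antisymm (le_of_forall_lt fun a ha => ?_) (le_of_forall_lt fun a ha => ?_)
  · lift a to ℝ≥0 using ha.ne_top
    have h1 := (hN.coe_lt_timeToArrival_iff _ _ _).1 ha
    rcases lt_or_ge a x with hax | hax
    · exact lt_of_lt_of_le (ENNReal.coe_lt_coe.2 hax) le_self_add
    · obtain ⟨d, rfl⟩ := exists_add_of_le hax
      rw [ENNReal.coe_add]
      refine ENNReal.add_lt_add_left ENNReal.coe_ne_top ?_
      rw [hN.coe_lt_timeToArrival_iff]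
      simp only [ENNReal.toNNReal_coe] at h1 ⊢
      rw [add_assoc, h1, h]
  · lift a to ℝ≥0 using ha.ne_top
    rw [hN.coe_lt_timeToArrival_iff]
    simp only [ENNReal.toNNReal_coe]
    rcases lt_or_ge a x with hax | hax
    · have h1 := hN.mono ω (show t ≤ t + a by simp)
      have h2 := hN.mono ω (show t + a ≤ t + x by gcongr)
      simp only at h1 h2
      omega
    · obtain ⟨d, rfl⟩ := exists_add_of_le hax
      rw [ENNReal.coe_add] at ha
      have ha' := (ENNReal.add_lt_add_iff_left ENNReal.coe_ne_top).1 ha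
      rw [hN.coe_lt_timeToArrival_iff] at ha'
      simp only [ENNReal.toNNReal_coe] at ha'
      rw [← add_assoc, ha', h]

/-- By monotonicity and right continuity, `N u ≤ c` holds exactly when `N q ≤ c` for some rational
`q > u`. The σ-algebra is left free because the ambient one, the supremum of the filtration and `ℱ
t` are all needed. -/
theorem measurable_random_time {Ω : Type u} [MeasurableSpace Ω] {N : ℝ≥0 → Ω → ℕ}
    (hmono : ∀ ω, Monotone (fun t => N t ω))
    (hright : ∀ t ω, ∃ r, t < r ∧ ∀ u, t ≤ u → u < r → N u ω = N t ω)
    (hmeas : ∀ t, Measurable (N t)) {u : Ω → ℝ≥0} (hu : Measurable u) :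
    Measurable (fun ω => N (u ω) ω) := by
  refine measurable_of_Iic fun c => ?_
  have : (fun ω => N (u ω) ω) ⁻¹' Set.Iic c
      = ⋃ q : ℚ≥0, {ω | u ω < (q : ℝ≥0)} ∩ {ω | N (q : ℝ≥0) ω ≤ c} := by
    ext ω
    simp only [Set.mem_preimage, Set.mem_Iic, Set.mem_inter_iff, Set.mem_ofPred_eq,
      Set.mem_iUnion]
    constructor
    · intro h
      obtain ⟨r, hr, hrN⟩ := hright (u ω) ω
      obtain ⟨q, hq1, hq2⟩ := exists_rat_btwn (show ((u ω : ℝ≥0) : ℝ) < r from hr)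
      have hq0 : 0 ≤ q := by
        have : (0 : ℝ) ≤ q := le_trans (u ω).2 hq1.le
        exact_mod_cast this
      lift q to ℚ≥0 using hq0
      have hq1' : u ω < (q : ℝ≥0) := by exact_mod_cast hq1
      refine ⟨q, hq1', ?_⟩
      rw [hrN _ hq1'.le (by exact_mod_cast hq2)]
      exact h
    · rintro ⟨q, h1, h2⟩
      exact (hmono ω h1.le).trans h2
  rw [this]
  exact MeasurableSet.iUnion fun q =>
    MeasurableSet.inter (hu measurableSet_Iio) (hmeas _ measurableSet_Iic)

theorem IsPoissonProcess.measurable_comp (hN : IsPoissonProcess P ℱ N) {u : Ω → ℝ≥0}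
    (hu : Measurable u) : Measurable (fun ω => N (u ω) ω) :=
  measurable_random_time hN.mono hN.exists_gt_forall_eq
    (fun t => (hN.adapted t).mono (ℱ.le t) le_rfl) hu

/-- Freezing the path at time `t` makes it right-continuous and `ℱ t`-measurable at all times,
without changing its values before `t`. -/
theorem IsPoissonProcess.measurable_comp_of_le (hN : IsPoissonProcess P ℱ N) {t : ℝ≥0}
    {u : Ω → ℝ≥0} (hu : Measurable[ℱ t] u) (hut : ∀ ω, u ω ≤ t) :
    Measurable[ℱ t] (fun ω => N (u ω) ω) := by
  have := @measurable_random_time Ω (ℱ t) (fun v ω => N (min v t) ω)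
    (fun ω a b hab => hN.mono ω (min_le_min_right t hab))
    (fun v ω => by
      obtain ⟨r, hr, hrN⟩ := hN.exists_gt_forall_eq (min v t) ω
      rcases le_or_gt t v with h | h
      · refine ⟨v + 1, by simp, fun w hw _ => ?_⟩
        rw [min_eq_right h, min_eq_right (h.trans hw)]
      · rw [min_eq_left h.le] at hr hrN
        refine ⟨r, hr, fun w hw hwr => ?_⟩
        rw [min_eq_left h.le]
        exact hrN _ (le_min hw h.le) ((min_le_left _ _).trans_lt hwr))
    (fun v => (hN.adapted (min v t)).mono (ℱ.mono (min_le_right _ _)) le_rfl) u hu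
  simpa only [min_eq_left (hut _)] using this

end Paths

theorem measurable_of_forall_le {Ω α : Type*} (m : MeasurableSpace Ω) [TopologicalSpace α]
    [LinearOrder α] [OrderTopology α] [SecondCountableTopology α] [MeasurableSpace α]
    [BorelSpace α] {f : Ω → α} (hf : ∀ c, MeasurableSet[m] {ω | f ω ≤ c}) : Measurable[m] f :=
  measurable_of_Iic hf

/-! ### Measurability at stopping times. -/

section StoppingTimes

variable {Ω : Type u} [mΩ : MeasurableSpace Ω] {P : Measure Ω} {ℱ : Filtration ℝ≥0 mΩ}
  {N : ℝ≥0 → Ω → ℕ} {σ ρ : Ω → ℝ≥0∞}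

theorem measurable_stoppingTime (hσ : IsStoppingTime ℱ σ) : Measurable[hσ.measurableSpace] σ := by
  refine measurable_of_forall_le _ fun c => ?_
  induction c with
  | top => simp
  | coe c => exact hσ.measurableSet_le' c

theorem measurableSet_inter_le_coe (hσ : IsStoppingTime ℱ σ) {A : Set Ω}
    (hA : MeasurableSet[hσ.measurableSpace] A) (t : ℝ≥0) :
    MeasurableSet[ℱ t] (A ∩ {ω | σ ω ≤ t}) := hA.2 t

theorem IsPoissonProcess.measurable_at_stoppingTime (hN : IsPoissonProcess P ℱ N)
    (hσ : IsStoppingTime ℱ σ) :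
    Measurable[hσ.measurableSpace] (fun ω => N (σ ω).toNNReal ω) := by
  intro S hS
  refine ⟨?_, fun t => ?_⟩
  · refine @measurable_random_time Ω (⨆ t, ℱ t) N hN.mono hN.exists_gt_forall_eq
      (fun t => (hN.adapted t).mono (le_iSup (fun t => ℱ t) t) le_rfl) _ ?_ S hS
    exact ENNReal.measurable_toNNReal.comp
      ((measurable_stoppingTime hσ).mono (fun s hs => hs.1) le_rfl)
  -- On `{σ ≤ t}` the count at `σ` is the count at `min σ t`, which depends on the path up to `t`
  -- only.
  · have hu : Measurable[ℱ t] (fun ω => (min (σ ω) t).toNNReal) := by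
      refine measurable_of_forall_le _ fun c => ?_
      rcases le_total t c with h | h
      · convert MeasurableSet.univ
        ext ω
        simp only [Set.mem_univ, Set.mem_ofPred_eq, iff_true]
        exact (ENNReal.toNNReal_mono ENNReal.coe_ne_top (min_le_right _ _)).trans (by simpa using h)
      · rcases eq_or_lt_of_le h with rfl | h
        · convert MeasurableSet.univ
          ext ω
          simp only [Set.mem_univ, Set.mem_ofPred_eq, iff_true]
          exact (ENNReal.toNNReal_mono ENNReal.coe_ne_top (min_le_right _ _)).trans (by simp)
        convert ℱ.mono h.le _ (hσ c) using 1
        ext ω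
        simp only [Set.mem_ofPred_eq]
        have hf : min (σ ω) (t : ℝ≥0∞) ≠ ∞ := ne_top_of_le_ne_top ENNReal.coe_ne_top (min_le_right _ _)
        rw [← ENNReal.coe_le_coe, ENNReal.coe_toNNReal hf, min_le_iff]
        constructor
        · rintro (h1 | h1)
          · exact h1
          · exact absurd (ENNReal.coe_le_coe.1 h1) (not_le.2 h)
        · exact fun h1 => Or.inl h1
    have h := hN.measurable_comp_of_le hu (fun ω => by
      exact (ENNReal.toNNReal_mono ENNReal.coe_ne_top (min_le_right _ _)).trans (by simp)) hS
    convert MeasurableSet.inter h (hσ t) using 1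
    ext ω
    simp only [Set.mem_inter_iff, Set.mem_preimage, Set.mem_ofPred_eq]
    refine and_congr_left fun h1 => ?_
    rw [min_eq_left]
    exact h1

theorem IsPoissonProcess.measurable_timeToArrival (hN : IsPoissonProcess P ℱ N)
    (hσ : Measurable σ) : Measurable (fun ω => timeToArrival N (σ ω) ω) := by
  refine measurable_of_Iic fun c => ?_
  induction c with
  | top => simp
  | coe c =>
    have : (fun ω => timeToArrival N (σ ω) ω) ⁻¹' Set.Iic (c : ℝ≥0∞)
        = {ω | N (σ ω).toNNReal ω < N ((σ ω).toNNReal + c) ω} := by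
      ext ω
      exact hN.timeToArrival_le_coe_iff _ _ _
    rw [this]
    exact measurableSet_lt (hN.measurable_comp hσ.ennreal_toNNReal)
      (hN.measurable_comp (hσ.ennreal_toNNReal.add_const c))

theorem measurable_of_stoppingTime (hσ : IsStoppingTime ℱ σ) : Measurable σ :=
  (measurable_stoppingTime hσ).mono hσ.measurableSpace_le le_rfl

end StoppingTimes

/-! ### The strong Markov property at the first arrival after a stopping time. -/

section StrongMarkov

variable {Ω : Type u} [mΩ : MeasurableSpace Ω] {P : Measure Ω} {ℱ : Filtration ℝ≥0 mΩ}
  {N : ℝ≥0 → Ω → ℕ} {σ ρ : Ω → ℝ≥0∞}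

theorem IsPoissonProcess.measure_inter_no_arrival (hN : IsPoissonProcess P ℱ N) {A : Set Ω}
    {q : ℝ≥0} (hA : MeasurableSet[ℱ q] A) (v : ℝ≥0) :
    P (A ∩ {ω | N (q + v) ω = N q ω}) = P A * ENNReal.ofReal (Real.exp (-v)) := by
  have hind := hN.indep q (q + v) (by simp)
  rw [Indep_iff] at hind
  have h1 := hind ((fun ω => N (q + v) ω - N q ω) ⁻¹' {0}) A ⟨{0}, trivial, rfl⟩ hA
  have h2 : {ω | N (q + v) ω = N q ω} = (fun ω => N (q + v) ω - N q ω) ⁻¹' {0} := by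
    ext ω
    have := hN.mono ω (show q ≤ q + v by simp)
    simp only at this
    simp only [Set.mem_ofPred_eq, Set.mem_preimage, Set.mem_singleton_iff]
    omega
  have h3 : P ((fun ω => N (q + v) ω - N q ω) ⁻¹' {0}) = ENNReal.ofReal (Real.exp (-v)) := by
    have hl := hN.law q (q + v) (by simp)
    rw [← Measure.map_apply_of_aemeasurable hl.aemeasurable (measurableSet_singleton 0),
      hl.map_eq, poissonMeasure_singleton]
    simp
  rw [h2, Set.inter_comm, h1, h3, mul_comm]

/-- Round `σ` up to the grid of mesh `1 / (m + 1)`. On each cell the rounded time is deterministic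
and independence of increments applies; right continuity of the paths then allows `m → ∞`. -/
theorem IsPoissonProcess.measure_inter_lt_timeToArrival [IsFiniteMeasure P]
    (hN : IsPoissonProcess P ℱ N)
    (hσ : IsStoppingTime ℱ σ) {A : Set Ω} (hA : MeasurableSet[hσ.measurableSpace] A)
    (hfin : ∀ ω ∈ A, σ ω ≠ ∞) (v : ℝ≥0) :
    P (A ∩ {ω | (v : ℝ≥0∞) < timeToArrival N (σ ω) ω}) =
      P A * ENNReal.ofReal (Real.exp (-v)) := by
  have hσm := measurable_of_stoppingTime hσ
  have hAm : MeasurableSet A := hσ.measurableSpace_le _ hA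
  set ix : ℕ → Ω → ℕ := fun m ω => ⌈(σ ω).toNNReal * (m + 1)⌉₊ with hix
  set q : ℕ → ℕ → ℝ≥0 := fun m j => j / (m + 1) with hq
  have hixm : ∀ m, Measurable (ix m) := fun m =>
    Nat.measurable_ceil.comp (hσm.ennreal_toNNReal.mul_const _)
  have hle : ∀ m j ω, ix m ω ≤ j ↔ (σ ω).toNNReal ≤ q m j := by
    intro m j ω
    rw [hix, hq]
    simp only
    rw [Nat.ceil_le, le_div_iff₀ (by positivity)]
  have hlq : ∀ ω m, (σ ω).toNNReal ≤ q m (ix m ω) := fun ω m => (hle m _ ω).1 le_rfl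
  have hqu : ∀ ω m, q m (ix m ω) ≤ (σ ω).toNNReal + 1 / ((m : ℝ≥0) + 1) := by
    intro ω m
    rw [hq]
    simp only
    rw [div_le_iff₀ (by positivity), add_mul, div_mul_cancel₀ _ (by positivity)]
    exact (Nat.ceil_lt_add_one (by positivity)).le
  have hcell : ∀ m j, MeasurableSet[ℱ (q m j)] (A ∩ {ω | ix m ω = j}) := by
    intro m j
    have hc : ∀ i, i ≤ j → MeasurableSet[ℱ (q m j)] (A ∩ {ω | ix m ω ≤ i}) := by
      intro i hij
      have h1 := measurableSet_inter_le_coe hσ hA (q m i)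
      have hqq : q m i ≤ q m j := by
        rw [hq]
        simp only
        gcongr
      convert ℱ.mono hqq _ h1 using 1
      ext ω
      simp only [Set.mem_inter_iff, Set.mem_ofPred_eq]
      refine and_congr_right fun hω => ?_
      rw [hle, ← ENNReal.coe_le_coe, ENNReal.coe_toNNReal (hfin ω hω)]
    have heq : A ∩ {ω | ix m ω = j}
        = (A ∩ {ω | ix m ω ≤ j}) \ ⋃ i : Fin j, (A ∩ {ω | ix m ω ≤ i}) := by
      ext ω
      simp only [Set.mem_inter_iff, Set.mem_ofPred_eq, Set.mem_sdiff, Set.mem_iUnion, not_exists,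
        not_and, not_le]
      constructor
      · rintro ⟨h1, h2⟩
        exact ⟨⟨h1, h2.le⟩, fun i _ => by rw [h2]; exact i.2⟩
      · rintro ⟨⟨h1, h2⟩, h3⟩
        refine ⟨h1, le_antisymm h2 ?_⟩
        by_contra! h4
        exact lt_irrefl _ (h3 ⟨_, h4⟩ h1)
    rw [heq]
    exact MeasurableSet.diff (hc j le_rfl) (MeasurableSet.iUnion fun i => hc i i.2.le)
  have hstep : ∀ m, P (A ∩ {ω | N (q m (ix m ω) + v) ω = N (q m (ix m ω)) ω})
      = P A * ENNReal.ofReal (Real.exp (-v)) := by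
    intro m
    have h1 : A ∩ {ω | N (q m (ix m ω) + v) ω = N (q m (ix m ω)) ω}
        = ⋃ j, (A ∩ {ω | ix m ω = j}) ∩ {ω | N (q m j + v) ω = N (q m j) ω} := by
      ext ω
      simp only [Set.mem_inter_iff, Set.mem_ofPred_eq, Set.mem_iUnion]
      constructor
      · rintro ⟨h1, h2⟩
        exact ⟨_, ⟨h1, rfl⟩, h2⟩
      · rintro ⟨j, ⟨h1, rfl⟩, h2⟩
        exact ⟨h1, h2⟩
    have h2 : A = ⋃ j, (A ∩ {ω | ix m ω = j}) := by
      ext ω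
      simp
    have hd : Pairwise (Function.onFun Disjoint fun j => A ∩ {ω | ix m ω = j}) := by
      intro i j hij
      refine Set.disjoint_left.2 fun ω h1 h2 => hij ?_
      exact h1.2.symm.trans h2.2
    have hmm : ∀ j, MeasurableSet (A ∩ {ω | ix m ω = j}) := fun j => ℱ.le _ _ (hcell m j)
    have hN' : ∀ t, Measurable (N t) := fun t => (hN.adapted t).mono (ℱ.le t) le_rfl
    rw [h1, measure_iUnion]
    · conv_rhs => rw [h2, measure_iUnion hd hmm, ← ENNReal.tsum_mul_right]
      exact tsum_congr fun j => hN.measure_inter_no_arrival (hcell m j) v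
    · intro i j hij
      exact (hd hij).mono Set.inter_subset_left Set.inter_subset_left
    · exact fun j => (hmm j).inter (measurableSet_eq_fun (hN' _) (hN' _))
  have hlim := tendsto_measure_of_ae_tendsto_indicator_of_isFiniteMeasure (μ := P) atTop
    (A := A ∩ {ω | (v : ℝ≥0∞) < timeToArrival N (σ ω) ω})
    (As := fun m => A ∩ {ω | N (q m (ix m ω) + v) ω = N (q m (ix m ω)) ω})
    (hAm.inter (measurableSet_lt measurable_const (hN.measurable_timeToArrival hσm)))
    (fun m => by
      have hqm : Measurable (fun ω => q m (ix m ω)) := (measurable_from_top (f := q m)).comp (hixm m)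
      exact hAm.inter (measurableSet_eq_fun (hN.measurable_comp (hqm.add_const v))
        (hN.measurable_comp hqm)))
    -- The rounded times tend to `σ` from above, so the counts at the rounded time and `v` later are
    -- eventually those at `σ` and `σ + v`.
    (ae_of_all _ fun ω => by
      obtain ⟨r1, hr1, hN1⟩ := hN.exists_gt_forall_eq (σ ω).toNNReal ω
      obtain ⟨r2, hr2, hN2⟩ := hN.exists_gt_forall_eq ((σ ω).toNNReal + v) ω
      have ht : Tendsto (fun m => q m (ix m ω)) atTop (nhds (σ ω).toNNReal) := by
        refine tendsto_of_tendsto_of_tendsto_of_le_of_le tendsto_const_nhds ?_ (hlq ω) (hqu ω)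
        conv => rhs; rw [← add_zero (σ ω).toNNReal]
        exact tendsto_const_nhds.add (tendsto_one_div_add_atTop_nhds_zero_nat (𝕜 := ℝ≥0))
      filter_upwards [ht.eventually_lt_const hr1, (ht.add_const v).eventually_lt_const hr2]
        with m h1 h2
      simp only [Set.mem_inter_iff, Set.mem_ofPred_eq]
      rw [hN1 _ (hlq ω m) h1, hN2 _ (by gcongr; exact hlq ω m) h2,
        hN.coe_lt_timeToArrival_iff])
  simp only [hstep] at hlim
  exact tendsto_nhds_unique hlim tendsto_const_nhds |>.symm ▸ rfl

theorem expMeasure_Ioi {v : ℝ} (hv : 0 ≤ v) :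
    expMeasure 1 (Set.Ioi v) = ENNReal.ofReal (Real.exp (-v)) := by
  have := isProbabilityMeasure_expMeasure (r := 1) one_pos
  have h := cdf_expMeasure_eq (r := 1) one_pos v
  rw [cdf_eq_real, if_pos hv] at h
  rw [← Set.compl_Iic, ← ofReal_measureReal, probReal_compl_eq_one_sub measurableSet_Iic, h]
  congr 1
  ring_nf

theorem expMeasure_Iic_of_neg {v : ℝ} (hv : v < 0) : expMeasure 1 (Set.Iic v) = 0 := by
  have := isProbabilityMeasure_expMeasure (r := 1) one_pos
  have h := cdf_expMeasure_eq (r := 1) one_pos v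
  rw [cdf_eq_real, if_neg (not_le.2 hv)] at h
  rw [← ofReal_measureReal, h, ENNReal.ofReal_zero]

theorem IsPoissonProcess.ae_timeToArrival_ne_top [IsFiniteMeasure P]
    (hN : IsPoissonProcess P ℱ N) (hσ : IsStoppingTime ℱ σ) {A : Set Ω}
    (hA : MeasurableSet[hσ.measurableSpace] A) (hfin : ∀ ω ∈ A, σ ω ≠ ∞) :
    ∀ᵐ ω ∂P.restrict A, timeToArrival N (σ ω) ω ≠ ∞ := by
  have hAm : MeasurableSet A := hσ.measurableSpace_le _ hA
  rw [ae_iff, Measure.restrict_apply₀']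
  swap
  · exact hAm.nullMeasurableSet
  have hb : ∀ n : ℕ, P ({ω | ¬timeToArrival N (σ ω) ω ≠ ∞} ∩ A)
      ≤ P A * ENNReal.ofReal (Real.exp (-n)) := by
    intro n
    have := hN.measure_inter_lt_timeToArrival hσ hA hfin n
    simp only [NNReal.coe_natCast] at this
    rw [← this]
    refine measure_mono fun ω hω => ⟨hω.2, ?_⟩
    have : timeToArrival N (σ ω) ω = ∞ := by simpa using hω.1
    simp [this]
  have hl : Tendsto (fun n : ℕ => P A * ENNReal.ofReal (Real.exp (-n))) atTop (nhds (P A * 0)) := by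
    refine ENNReal.Tendsto.const_mul ?_ (Or.inr (measure_ne_top P A))
    rw [← ENNReal.ofReal_zero]
    refine ENNReal.tendsto_ofReal ?_
    exact Real.tendsto_exp_neg_atTop_nhds_zero.comp tendsto_natCast_atTop_atTop
  rw [mul_zero] at hl
  exact le_antisymm (ge_of_tendsto' hl hb) bot_le

/-- Strong Markov property: after a stopping time `σ`, the waiting time for the next arrival is
exponential and independent of the past of `σ`. -/
theorem IsPoissonProcess.map_restrict_timeToArrival [IsFiniteMeasure P]
    (hN : IsPoissonProcess P ℱ N) (hσ : IsStoppingTime ℱ σ) {A : Set Ω}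
    (hA : MeasurableSet[hσ.measurableSpace] A) (hfin : ∀ ω ∈ A, σ ω ≠ ∞) :
    (P.restrict A).map (fun ω => (timeToArrival N (σ ω) ω).toReal) = P A • expMeasure 1 := by
  have := isProbabilityMeasure_expMeasure (r := 1) one_pos
  have hσm := measurable_of_stoppingTime hσ
  have hAm : MeasurableSet A := hσ.measurableSpace_le _ hA
  have hτ := hN.measurable_timeToArrival hσm
  have : IsFiniteMeasure (P A • expMeasure 1) := by
    refine ⟨?_⟩
    simp [Measure.smul_apply, measure_lt_top]
  have huniv : (P.restrict A).map (fun ω => (timeToArrival N (σ ω) ω).toReal) Set.univ = P A := by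
    rw [Measure.map_apply hτ.ennreal_toReal MeasurableSet.univ]
    simp
  refine Measure.ext_of_Iic _ _ fun a => ?_
  rcases lt_or_ge a 0 with ha | ha
  · rw [Measure.smul_apply, expMeasure_Iic_of_neg ha, smul_zero,
      Measure.map_apply hτ.ennreal_toReal measurableSet_Iic]
    convert measure_empty (μ := P.restrict A)
    ext ω
    simp only [Set.mem_preimage, Set.mem_Iic, Set.mem_empty_iff_false, iff_false, not_le]
    exact ha.trans_le ENNReal.toReal_nonneg
  · lift a to ℝ≥0 using ha
    rw [← compl_compl (Set.Iic (a : ℝ)), Set.compl_Iic,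
      measure_compl measurableSet_Ioi (measure_ne_top _ _),
      measure_compl measurableSet_Ioi (measure_ne_top _ _), huniv]
    congr 1
    · simp
    rw [Measure.smul_apply, expMeasure_Ioi a.coe_nonneg, smul_eq_mul,
      ← hN.measure_inter_lt_timeToArrival hσ hA hfin,
      Measure.map_apply hτ.ennreal_toReal measurableSet_Ioi]
    rw [Set.inter_comm, ← Measure.restrict_apply' hAm]
    refine measure_congr ?_
    filter_upwards [hN.ae_timeToArrival_ne_top hσ hA hfin] with ω hω
    refine eq_iff_iff.2 ?_
    change (a : ℝ) < (timeToArrival N (σ ω) ω).toReal ↔ (a : ℝ≥0∞) < timeToArrival N (σ ω) ω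
    lift timeToArrival N (σ ω) ω to ℝ≥0 using hω with w
    simp

theorem IsPoissonProcess.measure_inter_timeToArrival_mem [IsFiniteMeasure P]
    (hN : IsPoissonProcess P ℱ N) (hσ : IsStoppingTime ℱ σ) {A : Set Ω}
    (hA : MeasurableSet[hσ.measurableSpace] A) (hfin : ∀ ω ∈ A, σ ω ≠ ∞) {S : Set ℝ}
    (hS : MeasurableSet S) :
    P (A ∩ {ω | (timeToArrival N (σ ω) ω).toReal ∈ S}) = P A * expMeasure 1 S := by
  have hAm : MeasurableSet A := hσ.measurableSpace_le _ hA
  have h := congrArg (fun μ => μ S) (hN.map_restrict_timeToArrival hσ hA hfin)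
  rw [Measure.map_apply (hN.measurable_timeToArrival (measurable_of_stoppingTime hσ)).ennreal_toReal
    hS, Measure.restrict_apply' hAm, Measure.smul_apply, smul_eq_mul] at h
  rw [← h, Set.inter_comm]
  rfl

/-- On `A` the joint law of `X`, known at `σ`, and the waiting time is a product measure, so the
integral is an iterated one. -/
theorem IsPoissonProcess.lintegral_timeToArrival [IsFiniteMeasure P]
    (hN : IsPoissonProcess P ℱ N) (hσ : IsStoppingTime ℱ σ) {A : Set Ω}
    (hA : MeasurableSet[hσ.measurableSpace] A) (hfin : ∀ ω ∈ A, σ ω ≠ ∞) {X : Ω → ℝ}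
    (hX : Measurable[hσ.measurableSpace] X) {f : ℝ → ℝ → ℝ≥0∞}
    (hf : Measurable (Function.uncurry f)) :
    ∫⁻ ω in A, f (X ω) (timeToArrival N (σ ω) ω).toReal ∂P
      = ∫⁻ ω in A, ∫⁻ v, f (X ω) v ∂expMeasure 1 ∂P := by
  have := isProbabilityMeasure_expMeasure (r := 1) one_pos
  have hσm := measurable_of_stoppingTime hσ
  have hτ := (hN.measurable_timeToArrival hσm).ennreal_toReal
  have hXm : Measurable X := hX.mono hσ.measurableSpace_le le_rfl
  have hAm : MeasurableSet A := hσ.measurableSpace_le _ hA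
  have hprod : ((P.restrict A).map X).prod (expMeasure 1)
      = (P.restrict A).map (fun ω => (X ω, (timeToArrival N (σ ω) ω).toReal)) := by
    refine Measure.prod_eq fun S U hS hU => ?_
    rw [Measure.map_apply (hXm.prodMk hτ) (hS.prod hU), Measure.map_apply hXm hS,
      Measure.restrict_apply' hAm, Measure.restrict_apply' hAm,
      ← hN.measure_inter_timeToArrival_mem hσ (MeasurableSet.inter (hX hS) hA)
        (fun ω hω => hfin ω hω.2) hU]
    congr 1
    ext ω
    simp only [Set.mk_preimage_prod, Set.mem_inter_iff, Set.mem_preimage, Set.mem_ofPred_eq]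
    tauto
  have h1 : ∫⁻ ω in A, f (X ω) (timeToArrival N (σ ω) ω).toReal ∂P
      = ∫⁻ z, Function.uncurry f z
        ∂(P.restrict A).map (fun ω => (X ω, (timeToArrival N (σ ω) ω).toReal)) := by
    rw [lintegral_map hf (hXm.prodMk hτ)]
    rfl
  rw [h1, ← hprod, lintegral_prod _ hf.aemeasurable, lintegral_map hf.lintegral_prod_right' hXm]
  rfl

end StrongMarkov

/-! ### The expected excess of an exponential variable and its tangency inequality. -/

section Cost

/-- The expectation of `((d + τ)⁺)² / 2` for an exponential variable `τ` of mean one. -/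
noncomputable def expectedExcess (d : ℝ) : ℝ :=
  if d ≤ 0 then Real.exp d else d ^ 2 / 2 + d + 1

theorem lintegral_expMeasure (f : ℝ → ℝ≥0∞) :
    ∫⁻ v, f v ∂expMeasure 1 = ∫⁻ v, exponentialPDF 1 v * f v := by
  have h : Measurable (exponentialPDF 1) :=
    (measurable_exponentialPDFReal 1).ennreal_ofReal
  have h2 : expMeasure 1 = volume.withDensity (exponentialPDF 1) := rfl
  rw [h2, lintegral_withDensity_eq_lintegral_mul_non_measurable _ h]
  · rfl
  · exact ae_of_all _ fun v => ENNReal.ofReal_lt_top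

theorem lintegral_excess (d : ℝ) :
    ∫⁻ v, ENNReal.ofReal ((max (d + v) 0) ^ 2 / 2) ∂expMeasure 1
      = ENNReal.ofReal (expectedExcess d) := by
  set a : ℝ := max 0 (-d) with ha
  have ha0 : 0 ≤ a := le_max_left _ _
  have had : -d ≤ a := le_max_right _ _
  -- An antiderivative of the density times the excess on `[a, ∞)`, vanishing at infinity; below `a`
  -- either the density or the excess is zero.
  set F : ℝ → ℝ := fun v => -(Real.exp (-v) * ((d + v) ^ 2 / 2 + (d + v) + 1)) with hF
  have hder : ∀ v ∈ Set.Ici a, HasDerivAt F (Real.exp (-v) * ((d + v) ^ 2 / 2)) v := by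
    intro v _
    have h1 : HasDerivAt (fun v : ℝ => Real.exp (-v)) (Real.exp (-v) * -1) v :=
      (hasDerivAt_neg v).exp
    have h2 : HasDerivAt (fun v : ℝ => d + v) 1 v := (hasDerivAt_id v).const_add d
    have h3 := (h1.mul ((((h2.pow 2).div_const 2).add h2).add_const 1)).neg
    refine h3.congr_deriv ?_
    simp
    ring
  have hlim : Tendsto F atTop (nhds 0) := by
    have e2 := Real.tendsto_pow_mul_exp_neg_atTop_nhds_zero 2
    have e1 := Real.tendsto_pow_mul_exp_neg_atTop_nhds_zero 1
    have e0 := Real.tendsto_pow_mul_exp_neg_atTop_nhds_zero 0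
    have := (((e2.const_mul (1 / 2)).add (e1.const_mul (d + 1))).add
      (e0.const_mul (d ^ 2 / 2 + d + 1))).neg
    simp only [mul_zero, add_zero, neg_zero] at this
    refine this.congr fun v => ?_
    rw [hF]
    ring
  have hnn : ∀ v ∈ Set.Ioi a, 0 ≤ Real.exp (-v) * ((d + v) ^ 2 / 2) := fun v _ => by positivity
  have hint := integrableOn_Ioi_deriv_of_nonneg' hder hnn hlim
  have hval := integral_Ioi_of_hasDerivAt_of_nonneg' hder hnn hlim
  rw [lintegral_expMeasure]
  have h1 : ∀ v, exponentialPDF 1 v * ENNReal.ofReal ((max (d + v) 0) ^ 2 / 2)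
      = (Set.Ici a).indicator (fun v => ENNReal.ofReal (Real.exp (-v) * ((d + v) ^ 2 / 2))) v := by
    intro v
    by_cases hv : v ∈ Set.Ici a
    · rw [Set.indicator_of_mem hv]
      have hv' : a ≤ v := hv
      rw [exponentialPDF_of_nonneg (ha0.trans hv'), ← ENNReal.ofReal_mul (by positivity),
        max_eq_left (by linarith)]
      simp
    · rw [Set.indicator_of_notMem hv]
      have hv' : v < max 0 (-d) := not_le.1 hv
      rcases lt_max_iff.1 hv' with h | h
      · rw [exponentialPDF_of_neg h, zero_mul]
      · rw [max_eq_right (by linarith)]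
        simp
  simp_rw [h1]
  rw [lintegral_indicator measurableSet_Ici, setLIntegral_congr Ioi_ae_eq_Ici.symm,
    ← ofReal_integral_eq_lintegral_ofReal hint
      ((ae_restrict_iff' measurableSet_Ioi).2 (ae_of_all _ hnn)), hval]
  congr 1
  rw [hF, expectedExcess]
  simp only
  split_ifs with hd
  · rw [ha, max_eq_right (by linarith)]
    simp
  · rw [ha, max_eq_left (by linarith)]
    simp

theorem excess_le {d e : ℝ} (h : e ≤ d) : (max e 0) ^ 2 / 2 ≤ d ^ 2 / 2 := by
  rcases le_total e 0 with h1 | h1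
  · rw [max_eq_right h1]
    nlinarith [sq_nonneg d]
  · rw [max_eq_left h1]
    nlinarith

/-- Updating at age `l + d` never beats the threshold once the option is priced at `exp (-h)` per
unit of the martingale. For `d > 0` this is the tangent bound `exp (d - h) ≥ 1 + d - h`; for `d ≤ 0`
it follows from `exp d ≤ 1` and `1 - exp (-h) ≤ h`. -/
theorem expectedExcess_le_stop (d : ℝ) {h : ℝ} (hh : 0 ≤ h) :
    expectedExcess d ≤ d ^ 2 / 2 + h + Real.exp (-h) * Real.exp d := by
  unfold expectedExcess
  split_ifs with hd
  · have h1 : 1 - h ≤ Real.exp (-h) := by linarith [Real.add_one_le_exp (-h)]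
    have h2 : Real.exp d ≤ 1 := Real.exp_le_one_iff.2 hd
    have h3 : Real.exp (-h) ≤ 1 := Real.exp_le_one_iff.2 (by linarith)
    nlinarith [sq_nonneg d, Real.exp_pos d, mul_nonneg (sub_nonneg.2 h2) (sub_nonneg.2 h3)]
  · rw [← Real.exp_add]
    linarith [Real.add_one_le_exp (-h + d)]

/-- The equality case `d = h`, which identifies the optimal threshold `l + h`. -/
theorem expectedExcess_stop {h : ℝ} (hh : 0 ≤ h) :
    h ^ 2 / 2 + h + Real.exp (-h) * Real.exp h = expectedExcess h := by
  rw [← Real.exp_add, neg_add_cancel, Real.exp_zero]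
  unfold expectedExcess
  split_ifs with hd
  · have : h = 0 := le_antisymm hd hh
    simp [this]
  · rfl

/-- The extra charge `1 + x` pays for a delay cut off at the horizon before any arrival. -/
theorem expectedExcess_le_wait {x l : ℝ} (hx : 0 ≤ x) (hl : 0 ≤ l) :
    expectedExcess (x - l) ≤ (x - l) ^ 2 / 2 + (1 + x) := by
  unfold expectedExcess
  split_ifs with hd
  · have h2 : Real.exp (x - l) ≤ 1 := Real.exp_le_one_iff.2 hd
    nlinarith [sq_nonneg (x - l)]
  · linarith

end Cost

/-! ### Identities for one delay between two stopping times. -/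

section OneStep

variable {Ω : Type u} [mΩ : MeasurableSpace Ω] {P : Measure Ω} {ℱ : Filtration ℝ≥0 mΩ}
  {N : ℝ≥0 → Ω → ℕ} {σ ρ : Ω → ℝ≥0∞} {A : Set Ω}

/-- The event that no energy arrives in the random interval `(σ, ρ]`. -/
def noArrival (N : ℝ≥0 → Ω → ℕ) (σ ρ : Ω → ℝ≥0∞) : Set Ω :=
  {ω | N (ρ ω).toNNReal ω = N (σ ω).toNNReal ω}

theorem measurable_mono_stoppingTime {β : Type*} [MeasurableSpace β] (hσ : IsStoppingTime ℱ σ)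
    (hρ : IsStoppingTime ℱ ρ) (hle : ∀ ω, σ ω ≤ ρ ω) {X : Ω → β}
    (hX : Measurable[hσ.measurableSpace] X) : Measurable[hρ.measurableSpace] X :=
  hX.mono (IsStoppingTime.measurableSpace_mono hσ hρ hle) le_rfl

theorem IsPoissonProcess.measurableSet_noArrival (hN : IsPoissonProcess P ℱ N)
    (hσ : IsStoppingTime ℱ σ) (hρ : IsStoppingTime ℱ ρ) (hle : ∀ ω, σ ω ≤ ρ ω) :
    MeasurableSet[hρ.measurableSpace] (noArrival N σ ρ) :=
  measurableSet_eq_fun (hN.measurable_at_stoppingTime hρ)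
    (measurable_mono_stoppingTime hσ hρ hle (hN.measurable_at_stoppingTime hσ))

theorem IsPoissonProcess.timeToArrival_of_mem_noArrival (hN : IsPoissonProcess P ℱ N) {ω : Ω}
    (hle : σ ω ≤ ρ ω) (hfin : ρ ω ≠ ∞) (h : ω ∈ noArrival N σ ρ) :
    timeToArrival N (σ ω) ω = (ρ ω - σ ω) + timeToArrival N (ρ ω) ω := by
  have hs : σ ω ≠ ∞ := ne_top_of_le_ne_top hfin hle
  unfold noArrival at h
  simp only [Set.mem_ofPred_eq] at h
  lift σ ω to ℝ≥0 using hs with s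
  lift ρ ω to ℝ≥0 using hfin with r
  obtain ⟨x, rfl⟩ := exists_add_of_le (ENNReal.coe_le_coe.1 hle)
  simp only [ENNReal.toNNReal_coe] at h
  rw [hN.timeToArrival_add s x ω h, ENNReal.coe_add, ENNReal.add_sub_cancel_left ENNReal.coe_ne_top]

theorem IsPoissonProcess.timeToArrival_le_of_notMem_noArrival (hN : IsPoissonProcess P ℱ N) {ω : Ω}
    (hle : σ ω ≤ ρ ω) (hfin : ρ ω ≠ ∞) (h : ω ∉ noArrival N σ ρ) :
    timeToArrival N (σ ω) ω ≤ ρ ω - σ ω := by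
  have hs : σ ω ≠ ∞ := ne_top_of_le_ne_top hfin hle
  unfold noArrival at h
  simp only [Set.mem_ofPred_eq] at h
  lift σ ω to ℝ≥0 using hs with s
  lift ρ ω to ℝ≥0 using hfin with r
  obtain ⟨x, rfl⟩ := exists_add_of_le (ENNReal.coe_le_coe.1 hle)
  simp only [ENNReal.toNNReal_coe] at h
  rw [ENNReal.coe_add, ENNReal.add_sub_cancel_left ENNReal.coe_ne_top, hN.timeToArrival_le_coe_iff]
  simp only [ENNReal.toNNReal_coe]
  exact lt_of_le_of_ne (hN.mono ω (by simp)) (Ne.symm h)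

/-- Without an arrival in `(σ, ρ]` the wait from `σ` is `ρ - σ` plus the wait from `ρ`, and the
latter is a fresh exponential variable by the strong Markov property at `ρ`. -/
theorem IsPoissonProcess.lintegral_split [IsFiniteMeasure P] (hN : IsPoissonProcess P ℱ N)
    (hσ : IsStoppingTime ℱ σ) (hρ : IsStoppingTime ℱ ρ) (hle : ∀ ω, σ ω ≤ ρ ω)
    (hA : MeasurableSet[hσ.measurableSpace] A) (hfin : ∀ ω ∈ A, σ ω ≠ ∞)
    (hfin' : ∀ᵐ ω ∂P, ω ∈ A → ρ ω ≠ ∞) {f : ℝ → ℝ≥0∞} (hf : Measurable f) :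
    ∫⁻ ω in A \ noArrival N σ ρ, f (timeToArrival N (σ ω) ω).toReal ∂P
      + ∫⁻ ω in A ∩ noArrival N σ ρ, ∫⁻ v, f ((ρ ω - σ ω).toReal + v) ∂expMeasure 1 ∂P
      = P A * ∫⁻ v, f v ∂expMeasure 1 := by
  have hAρ : MeasurableSet[hρ.measurableSpace] A :=
    IsStoppingTime.measurableSpace_mono hσ hρ hle _ hA
  have hB := MeasurableSet.inter (MeasurableSet.inter hAρ
    (hN.measurableSet_noArrival hσ hρ hle)) (measurable_stoppingTime hρ (measurableSet_singleton ∞).compl)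
  have hX : Measurable[hρ.measurableSpace] (fun ω => (ρ ω - σ ω).toReal) :=
    ((measurable_stoppingTime hρ).sub
      (measurable_mono_stoppingTime hσ hρ hle (measurable_stoppingTime hσ))).ennreal_toReal
  have hfinB : ∀ ω ∈ A ∩ noArrival N σ ρ ∩ ρ ⁻¹' {∞}ᶜ, ρ ω ≠ ∞ := fun ω hω => hω.2
  have h1 := hN.lintegral_timeToArrival hσ hA hfin (X := fun _ => (0 : ℝ))
    measurable_const (f := fun _ v => f v) (hf.comp measurable_snd)
  have h2 := hN.lintegral_timeToArrival hρ hB hfinB hX (f := fun x v => f (x + v))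
    (hf.comp (measurable_fst.add measurable_snd))
  have hBB : (A ∩ noArrival N σ ρ : Set Ω) =ᵐ[P] (A ∩ noArrival N σ ρ ∩ ρ ⁻¹' {∞}ᶜ : Set Ω) := by
    filter_upwards [hfin'] with ω hω
    exact propext ⟨fun h => ⟨h, hω h.1⟩, fun h => h.1⟩
  rw [setLIntegral_congr hBB, ← h2]
  simp only [lintegral_const, Measure.restrict_apply MeasurableSet.univ, Set.univ_inter] at h1
  rw [mul_comm, ← h1, ← lintegral_inter_add_sdiff _ A
    (hρ.measurableSpace_le _ (hN.measurableSet_noArrival hσ hρ hle)), add_comm]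
  congr 1
  rw [setLIntegral_congr hBB]
  refine setLIntegral_congr_fun_ae (hρ.measurableSpace_le _ hB) ?_
  have hae := hN.ae_timeToArrival_ne_top hρ hB hfinB
  rw [ae_restrict_iff' (hρ.measurableSpace_le _ hB)] at hae
  filter_upwards [hae] with ω hω hmem
  rw [hN.timeToArrival_of_mem_noArrival (hle ω) (hfinB ω hmem) hmem.1.2,
    ENNReal.toReal_add (ENNReal.sub_ne_top (hfinB ω hmem)) (hω hmem)]

theorem IsPoissonProcess.lintegral_excess_split [IsFiniteMeasure P] (hN : IsPoissonProcess P ℱ N)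
    (hσ : IsStoppingTime ℱ σ) (hρ : IsStoppingTime ℱ ρ) (hle : ∀ ω, σ ω ≤ ρ ω)
    (hA : MeasurableSet[hσ.measurableSpace] A) (hfin : ∀ ω ∈ A, σ ω ≠ ∞)
    (hfin' : ∀ᵐ ω ∂P, ω ∈ A → ρ ω ≠ ∞) {l : ℝ} (hl : 0 ≤ l) :
    ∫⁻ ω in A \ noArrival N σ ρ,
        ENNReal.ofReal ((max ((timeToArrival N (σ ω) ω).toReal - l) 0) ^ 2 / 2) ∂P
      + ∫⁻ ω in A ∩ noArrival N σ ρ,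
        ENNReal.ofReal (expectedExcess ((ρ ω - σ ω).toReal - l)) ∂P
      = P A * ENNReal.ofReal (Real.exp (-l)) := by
  have h := hN.lintegral_split hσ hρ hle hA hfin hfin'
    (f := fun t => ENNReal.ofReal ((max (t - l) 0) ^ 2 / 2)) (by fun_prop)
  have e1 : ∫⁻ v, ENNReal.ofReal ((max (v - l) 0) ^ 2 / 2) ∂expMeasure 1
      = ENNReal.ofReal (Real.exp (-l)) := by
    have := lintegral_excess (-l)
    rw [expectedExcess, if_pos (by linarith)] at this
    rw [← this]
    simp only [neg_add_eq_sub]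
  have e2 : ∀ x : ℝ, ∫⁻ v, ENNReal.ofReal ((max (x + v - l) 0) ^ 2 / 2) ∂expMeasure 1
      = ENNReal.ofReal (expectedExcess (x - l)) := by
    intro x
    rw [← lintegral_excess (x - l)]
    refine lintegral_congr fun v => ?_
    rw [show x + v - l = x - l + v by ring]
  simp only [e1, e2] at h
  exact h

/-- Optional stopping for the martingale `exp t` on the event of no arrival, obtained by splitting
the probability of a wait longer than `K`. That wait forces no arrival by `ρ`, and then has
conditional probability `exp (-K)` times `exp (ρ - σ)`; the factor `exp (-K)` cancels. -/
theorem IsPoissonProcess.lintegral_exp_noArrival [IsFiniteMeasure P] (hN : IsPoissonProcess P ℱ N)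
    (hσ : IsStoppingTime ℱ σ) (hρ : IsStoppingTime ℱ ρ) (hle : ∀ ω, σ ω ≤ ρ ω)
    (hA : MeasurableSet[hσ.measurableSpace] A) (hfin : ∀ ω ∈ A, σ ω ≠ ∞) {K : ℝ≥0}
    (hK : ∀ ω ∈ A, ρ ω - σ ω ≤ K) :
    ∫⁻ ω in A ∩ noArrival N σ ρ, ENNReal.ofReal (Real.exp (ρ ω - σ ω).toReal) ∂P = P A := by
  have hρfin : ∀ ω ∈ A, ρ ω ≠ ∞ := by
    intro ω hω h
    have h1 := hK ω hω
    rw [h, ENNReal.top_sub (hfin ω hω)] at h1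
    exact absurd h1 (by simp)
  have h := hN.lintegral_split hσ hρ hle hA hfin (ae_of_all _ hρfin)
    (f := (Set.Ioi (K : ℝ)).indicator 1) (measurable_one.indicator measurableSet_Ioi)
  have hAm := hσ.measurableSpace_le _ hA
  have hB := hρ.measurableSpace_le _ (hN.measurableSet_noArrival hσ hρ hle)
  have e1 : ∫⁻ ω in A \ noArrival N σ ρ,
      (Set.Ioi (K : ℝ)).indicator 1 (timeToArrival N (σ ω) ω).toReal ∂P = 0 := by
    rw [setLIntegral_congr_fun (g := 0) (hAm.diff hB)]
    · simp
    · intro ω hω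
      refine Set.indicator_of_notMem ?_ _
      rw [Set.mem_Ioi, not_lt]
      exact ENNReal.toReal_le_coe_of_le_coe ((hN.timeToArrival_le_of_notMem_noArrival (hle ω)
        (hρfin ω hω.1) hω.2).trans (hK ω hω.1))
  have e2 : ∫⁻ ω in A ∩ noArrival N σ ρ, ∫⁻ v,
      (Set.Ioi (K : ℝ)).indicator 1 ((ρ ω - σ ω).toReal + v) ∂expMeasure 1 ∂P
      = ENNReal.ofReal (Real.exp (-K)) *
        ∫⁻ ω in A ∩ noArrival N σ ρ, ENNReal.ofReal (Real.exp (ρ ω - σ ω).toReal) ∂P := by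
    rw [← lintegral_const_mul' _ _ ENNReal.ofReal_ne_top]
    refine setLIntegral_congr_fun (hAm.inter hB) fun ω hω => ?_
    have hx : (ρ ω - σ ω).toReal ≤ K := ENNReal.toReal_le_coe_of_le_coe (hK ω hω.1)
    have : ∀ v : ℝ, (Set.Ioi (K : ℝ)).indicator (1 : ℝ → ℝ≥0∞) ((ρ ω - σ ω).toReal + v)
        = (Set.Ioi ((K : ℝ) - (ρ ω - σ ω).toReal)).indicator 1 v := by
      intro v
      simp only [Set.indicator_apply, Set.mem_Ioi, sub_lt_iff_lt_add', Pi.one_apply]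
    simp_rw [this]
    rw [lintegral_indicator_one measurableSet_Ioi, expMeasure_Ioi (by linarith),
      ← ENNReal.ofReal_mul (by positivity), ← Real.exp_add]
    congr 2
    ring
  rw [e1, e2, zero_add, lintegral_indicator_one measurableSet_Ioi, expMeasure_Ioi K.coe_nonneg, mul_comm]
    at h
  refine (ENNReal.mul_left_inj ?_ ENNReal.ofReal_ne_top).1 h
  simp [Real.exp_pos]

end OneStep

/-! ### The relative values and the choice of the critical rate. -/

section RelativeValue

/-- `relValue l b` is the relative value, when the average age is `l`, of the state right after
an update that leaves `b` units in the battery. -/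
noncomputable def relValue (l : ℝ) : ℕ → ℝ
  | 0 => Real.exp (-l) - l ^ 2 / 2
  | b + 1 => Real.exp (-l) * (1 - Real.exp (-relValue l b)) - l ^ 2 / 2

/-- The discounted value of the option to update before the next arrival. -/
noncomputable def stopCoeff (l : ℝ) : ℕ → ℝ
  | 0 => 0
  | b + 1 => Real.exp (-l) * Real.exp (-relValue l b)

theorem relValue_eq (l : ℝ) (b : ℕ) :
    relValue l b = Real.exp (-l) - stopCoeff l b - l ^ 2 / 2 := by
  cases b with
  | zero => simp [relValue, stopCoeff]
  | succ b => simp only [relValue, stopCoeff]; ring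

theorem stopCoeff_nonneg (l : ℝ) (b : ℕ) : 0 ≤ stopCoeff l b := by
  cases b with
  | zero => exact le_rfl
  | succ b => simp only [stopCoeff]; positivity

/-- `l` is a positive rate for which the relative value of the fullest state after an update
vanishes, the relative values of the other states being nonnegative. -/
structure IsCriticalRate (k : ℕ) (l : ℝ≥0) : Prop where
  pos : 0 < l
  last : relValue l (k - 1) = 0
  nonneg : ∀ b, b ≤ k - 1 → 0 ≤ relValue l b

theorem continuous_relValue (b : ℕ) : Continuous fun l => relValue l b := by
  induction b with
  | zero => simp only [relValue]; fun_prop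
  | succ b ih => simp only [relValue]; fun_prop

/-- All relative values are positive at `l = 0` and nonpositive at `l = 2`, so the last one vanishes
in between. For `l > 0` a nonpositive value makes all later ones negative, so no value before a
vanishing last one can be negative. -/
theorem exists_isCriticalRate (k : ℕ) : ∃ l, IsCriticalRate k l := by
  have h0 : ∀ b, 0 < relValue 0 b := by
    intro b
    induction b with
    | zero => simp [relValue]
    | succ b ih => simp [relValue, ih]
  have hneg : ∀ (l : ℝ) (b : ℕ), 0 < l → relValue l b ≤ 0 → relValue l (b + 1) < 0 := by
    intro l b hl hb
    have h1 : 1 ≤ Real.exp (-relValue l b) := Real.one_le_exp (by linarith)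
    have h2 : Real.exp (-l) * (1 - Real.exp (-relValue l b)) ≤ 0 :=
      mul_nonpos_of_nonneg_of_nonpos (Real.exp_pos _).le (by linarith)
    simp only [relValue]
    have : 0 < l ^ 2 := by positivity
    linarith
  have h2 : ∀ b, relValue 2 b ≤ 0 := by
    intro b
    induction b with
    | zero =>
      have : Real.exp (-2 : ℝ) ≤ 1 := Real.exp_le_one_iff.2 (by norm_num)
      simp only [relValue]
      linarith
    | succ b ih => exact (hneg 2 b (by norm_num) ih).le
  obtain ⟨l, hl, hl0⟩ := intermediate_value_Icc' (by norm_num : (0 : ℝ) ≤ 2)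
    (continuous_relValue (k - 1)).continuousOn ⟨h2 (k - 1), (h0 (k - 1)).le⟩
  simp only at hl0
  have hpos : 0 < l := by
    rcases hl.1.eq_or_lt with h | h
    · rw [← h] at hl0
      exact absurd hl0 (h0 _).ne'
    · exact h
  refine ⟨⟨l, hl.1⟩, hpos, hl0, fun b hb => ?_⟩
  by_contra! hb0
  have : ∀ d, relValue l (b + d) < 0 := by
    intro d
    induction d with
    | zero => exact hb0
    | succ d ih => exact hneg l _ hpos ih.le
  obtain ⟨d, hd⟩ := Nat.exists_eq_add_of_le hb
  have h3 := this d
  rw [← hd, hl0] at h3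
  exact lt_irrefl _ h3

end RelativeValue

/-! ### The optimality inequality for one delay, in both directions. -/

section OneStepBounds

variable {Ω : Type u} [mΩ : MeasurableSpace Ω] {P : Measure Ω} {ℱ : Filtration ℝ≥0 mΩ}
  {N : ℝ≥0 → Ω → ℕ} {σ ρ : Ω → ℝ≥0∞} {A : Set Ω}

/-- Completing the square, arranged so that no truncated subtraction occurs in `ℝ≥0∞`. -/
theorem sq_half_add (l : ℝ≥0) {X : ℝ≥0∞} (hX : X ≠ ∞) :
    ENNReal.ofReal ((X.toReal - l) ^ 2 / 2) + l * X
      = X ^ 2 / 2 + ENNReal.ofReal ((l : ℝ) ^ 2 / 2) := by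
  lift X to ℝ≥0 using hX
  have h1 : (l : ℝ≥0∞) * X = ENNReal.ofReal (l * X) := by
    rw [ENNReal.ofReal_mul l.coe_nonneg]; simp
  have h2 : (X : ℝ≥0∞) ^ 2 / 2 = ENNReal.ofReal ((X : ℝ) ^ 2 / 2) := by
    rw [ENNReal.ofReal_div_of_pos (by norm_num), ENNReal.ofReal_pow X.coe_nonneg]; simp
  rw [h1, h2, ENNReal.coe_toReal, ← ENNReal.ofReal_add (by positivity) (by positivity),
    ← ENNReal.ofReal_add (by positivity) (by positivity)]
  congr 1
  ring

theorem lintegral_sq_half_add (l : ℝ≥0) {X : Ω → ℝ≥0∞} (hX : Measurable X)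
    (hfin : ∀ᵐ ω ∂P, ω ∈ A → X ω ≠ ∞) (hA : MeasurableSet A) (Z : Ω → ℝ≥0∞) :
    ∫⁻ ω in A, (ENNReal.ofReal (((X ω).toReal - l) ^ 2 / 2) + Z ω) ∂P + ∫⁻ ω in A, l * X ω ∂P
      = ∫⁻ ω in A, ((X ω) ^ 2 / 2 + Z ω) ∂P + P A * ENNReal.ofReal ((l : ℝ) ^ 2 / 2) := by
  rw [← lintegral_add_right _ (hX.const_mul _), mul_comm (P A), ← setLIntegral_const,
    ← lintegral_add_right _ measurable_const]
  refine setLIntegral_congr_fun_ae hA ?_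
  filter_upwards [hfin] with ω hω hmem
  rw [add_right_comm, sq_half_add l (hω hmem), add_right_comm]

/-- With an arrival by `ρ`, the delay is at least the wait, so its cost dominates the excess.
Without one, `hZ` bounds the remaining excess by the cost plus a multiple of the martingale. The
mean of that multiple is `stopCoeff l b * P A`, which is what `relValue_eq` subtracts from `exp
(-l)`. -/
theorem IsPoissonProcess.lintegral_step_ge [IsProbabilityMeasure P] (hN : IsPoissonProcess P ℱ N)
    (hσ : IsStoppingTime ℱ σ) (hρ : IsStoppingTime ℱ ρ) (hle : ∀ ω, σ ω ≤ ρ ω)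
    (hA : MeasurableSet[hσ.measurableSpace] A) (hfin : ∀ ω ∈ A, σ ω ≠ ∞) {K : ℝ≥0}
    (hK : ∀ ω ∈ A, ρ ω - σ ω ≤ K) {l : ℝ≥0} {b : ℕ} (hb : 0 ≤ relValue l b) {Z : Ω → ℝ≥0∞}
    (hZ : ∀ᵐ ω ∂P, ω ∈ A → ω ∈ noArrival N σ ρ →
      ENNReal.ofReal (expectedExcess ((ρ ω - σ ω).toReal - l))
        ≤ ENNReal.ofReal (((ρ ω - σ ω).toReal - l) ^ 2 / 2) + Z ω
          + ENNReal.ofReal (stopCoeff l b) * ENNReal.ofReal (Real.exp (ρ ω - σ ω).toReal)) :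
    ∫⁻ ω in A, (l * (ρ ω - σ ω) + ENNReal.ofReal (relValue l b)) ∂P
      ≤ ∫⁻ ω in A, ((ρ ω - σ ω) ^ 2 / 2 + Z ω) ∂P := by
  have hAm := hσ.measurableSpace_le _ hA
  have hB := hρ.measurableSpace_le _ (hN.measurableSet_noArrival hσ hρ hle)
  have hX : Measurable fun ω => ρ ω - σ ω :=
    (measurable_of_stoppingTime hρ).sub (measurable_of_stoppingTime hσ)
  have hXfin : ∀ ω ∈ A, ρ ω - σ ω ≠ ∞ := fun ω hω =>
    ne_top_of_le_ne_top ENNReal.coe_ne_top (hK ω hω)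
  have hρfin : ∀ ω ∈ A, ρ ω ≠ ∞ := by
    intro ω hω h
    have := hXfin ω hω
    rw [h, ENNReal.top_sub (hfin ω hω)] at this
    exact this rfl
  have h1 := hN.lintegral_excess_split hσ hρ hle hA hfin (ae_of_all _ hρfin) l.coe_nonneg
  have h2 := hN.lintegral_exp_noArrival hσ hρ hle hA hfin hK
  set φ : Ω → ℝ≥0∞ := fun ω => ENNReal.ofReal (((ρ ω - σ ω).toReal - l) ^ 2 / 2) + Z ω with hφ
  have h3 : ∫⁻ ω in A \ noArrival N σ ρ,
        ENNReal.ofReal ((max ((timeToArrival N (σ ω) ω).toReal - l) 0) ^ 2 / 2) ∂P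
      ≤ ∫⁻ ω in A \ noArrival N σ ρ, φ ω ∂P := by
    refine setLIntegral_mono' (hAm.diff hB) fun ω hω => ?_
    refine le_trans (ENNReal.ofReal_le_ofReal (excess_le ?_)) le_self_add
    have := ENNReal.toReal_mono (hXfin ω hω.1) (hN.timeToArrival_le_of_notMem_noArrival (hle ω)
      (hρfin ω hω.1) hω.2)
    linarith
  have h4 : ∫⁻ ω in A ∩ noArrival N σ ρ,
        ENNReal.ofReal (expectedExcess ((ρ ω - σ ω).toReal - l)) ∂P
      ≤ ∫⁻ ω in A ∩ noArrival N σ ρ, φ ω ∂P + ENNReal.ofReal (stopCoeff l b) * P A := by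
    rw [← h2, ← lintegral_const_mul' _ _ ENNReal.ofReal_ne_top,
      ← lintegral_add_right _ (by fun_prop)]
    refine setLIntegral_mono_ae' (hAm.inter hB) ?_
    filter_upwards [hZ] with ω hω hmem
    exact hω hmem.1 hmem.2
  have h5 : P A * ENNReal.ofReal (Real.exp (-l))
      ≤ ∫⁻ ω in A, φ ω ∂P + ENNReal.ofReal (stopCoeff l b) * P A := by
    rw [← h1, ← lintegral_inter_add_sdiff φ A hB]
    calc _ ≤ _ := add_le_add h3 h4
      _ = _ := by ring
  have h6 := lintegral_sq_half_add (P := P) l hX (ae_of_all _ hXfin) hAm Z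
  have h7 : ENNReal.ofReal (Real.exp (-l)) = ENNReal.ofReal (relValue l b)
      + ENNReal.ofReal (stopCoeff l b) + ENNReal.ofReal ((l : ℝ) ^ 2 / 2) := by
    rw [← ENNReal.ofReal_add hb (stopCoeff_nonneg _ _),
      ← ENNReal.ofReal_add (add_nonneg hb (stopCoeff_nonneg _ _)) (by positivity), relValue_eq]
    congr 1
    ring
  rw [lintegral_add_right _ measurable_const, setLIntegral_const]
  -- Adding this finite quantity to both sides replaces the subtractions in the formula for
  -- `relValue`.
  have hfinC : P A * (ENNReal.ofReal (stopCoeff l b) + ENNReal.ofReal ((l : ℝ) ^ 2 / 2)) ≠ ∞ :=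
    ENNReal.mul_ne_top (measure_ne_top _ _) (by finiteness)
  refine (ENNReal.add_le_add_iff_right hfinC).1 ?_
  calc _ = P A * ENNReal.ofReal (Real.exp (-l)) + ∫⁻ ω in A, l * (ρ ω - σ ω) ∂P := by
        rw [h7]; ring
    _ ≤ _ := add_le_add_left h5 _
    _ = _ := by rw [add_right_comm, h6]; ring

/-- The same computation with the pointwise inequalities reversed, as they hold for an optimal
delay. At `b = 0` the coefficient of the martingale vanishes, so no bound on the delay is required
there. -/
theorem IsPoissonProcess.lintegral_step_le [IsProbabilityMeasure P] (hN : IsPoissonProcess P ℱ N)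
    (hσ : IsStoppingTime ℱ σ) (hρ : IsStoppingTime ℱ ρ) (hle : ∀ ω, σ ω ≤ ρ ω)
    (hA : MeasurableSet[hσ.measurableSpace] A) (hfin : ∀ ω ∈ A, σ ω ≠ ∞)
    (hfin' : ∀ᵐ ω ∂P, ω ∈ A → ρ ω ≠ ∞) {l : ℝ≥0} {b : ℕ} (hb : 0 ≤ relValue l b)
    (hK : b = 0 ∨ ∃ K : ℝ≥0, ∀ ω ∈ A, ρ ω - σ ω ≤ K) {Z : Ω → ℝ≥0∞}
    (hZ : ∀ᵐ ω ∂P, ω ∈ A → ω ∈ noArrival N σ ρ →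
      ENNReal.ofReal (((ρ ω - σ ω).toReal - l) ^ 2 / 2) + Z ω
          + ENNReal.ofReal (stopCoeff l b) * ENNReal.ofReal (Real.exp (ρ ω - σ ω).toReal)
        ≤ ENNReal.ofReal (expectedExcess ((ρ ω - σ ω).toReal - l)))
    (hZ' : ∀ᵐ ω ∂P, ω ∈ A → ω ∉ noArrival N σ ρ →
      ENNReal.ofReal (((ρ ω - σ ω).toReal - l) ^ 2 / 2) + Z ω
        ≤ ENNReal.ofReal ((max ((timeToArrival N (σ ω) ω).toReal - l) 0) ^ 2 / 2)) :
    ∫⁻ ω in A, ((ρ ω - σ ω) ^ 2 / 2 + Z ω) ∂P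
      ≤ ∫⁻ ω in A, (l * (ρ ω - σ ω) + ENNReal.ofReal (relValue l b)) ∂P := by
  have hAm := hσ.measurableSpace_le _ hA
  have hB := hρ.measurableSpace_le _ (hN.measurableSet_noArrival hσ hρ hle)
  have hX : Measurable fun ω => ρ ω - σ ω :=
    (measurable_of_stoppingTime hρ).sub (measurable_of_stoppingTime hσ)
  have hXfin : ∀ᵐ ω ∂P, ω ∈ A → ρ ω - σ ω ≠ ∞ := by
    filter_upwards [hfin'] with ω hω hmem
    exact ENNReal.sub_ne_top (hω hmem)
  have h1 := hN.lintegral_excess_split hσ hρ hle hA hfin hfin' l.coe_nonneg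
  set φ : Ω → ℝ≥0∞ := fun ω => ENNReal.ofReal (((ρ ω - σ ω).toReal - l) ^ 2 / 2) + Z ω with hφ
  have h3 : ∫⁻ ω in A \ noArrival N σ ρ, φ ω ∂P
      ≤ ∫⁻ ω in A \ noArrival N σ ρ,
        ENNReal.ofReal ((max ((timeToArrival N (σ ω) ω).toReal - l) 0) ^ 2 / 2) ∂P := by
    refine setLIntegral_mono_ae' (hAm.diff hB) ?_
    filter_upwards [hZ'] with ω hω hmem
    exact hω hmem.1 hmem.2
  have h2 : ENNReal.ofReal (stopCoeff l b) *
      ∫⁻ ω in A ∩ noArrival N σ ρ, ENNReal.ofReal (Real.exp (ρ ω - σ ω).toReal) ∂P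
      = ENNReal.ofReal (stopCoeff l b) * P A := by
    rcases hK with rfl | ⟨K, hK⟩
    · simp [stopCoeff]
    · rw [hN.lintegral_exp_noArrival hσ hρ hle hA hfin hK]
  have h4 : ∫⁻ ω in A ∩ noArrival N σ ρ, φ ω ∂P + ENNReal.ofReal (stopCoeff l b) * P A
      ≤ ∫⁻ ω in A ∩ noArrival N σ ρ,
        ENNReal.ofReal (expectedExcess ((ρ ω - σ ω).toReal - l)) ∂P := by
    rw [← h2, ← lintegral_const_mul' _ _ ENNReal.ofReal_ne_top,
      ← lintegral_add_right _ (by fun_prop)]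
    refine setLIntegral_mono_ae' (hAm.inter hB) ?_
    filter_upwards [hZ] with ω hω hmem
    exact hω hmem.1 hmem.2
  have h5 : ∫⁻ ω in A, φ ω ∂P + ENNReal.ofReal (stopCoeff l b) * P A
      ≤ P A * ENNReal.ofReal (Real.exp (-l)) := by
    rw [← h1, ← lintegral_inter_add_sdiff φ A hB]
    calc _ = _ := by ring
      _ ≤ _ := add_le_add h3 h4
  have h6 := lintegral_sq_half_add (P := P) l hX hXfin hAm Z
  have h7 : ENNReal.ofReal (Real.exp (-l)) = ENNReal.ofReal (relValue l b)
      + ENNReal.ofReal (stopCoeff l b) + ENNReal.ofReal ((l : ℝ) ^ 2 / 2) := by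
    rw [← ENNReal.ofReal_add hb (stopCoeff_nonneg _ _),
      ← ENNReal.ofReal_add (add_nonneg hb (stopCoeff_nonneg _ _)) (by positivity), relValue_eq]
    congr 1
    ring
  rw [lintegral_add_right _ measurable_const, setLIntegral_const]
  have hfinC : P A * (ENNReal.ofReal (stopCoeff l b) + ENNReal.ofReal ((l : ℝ) ^ 2 / 2)) ≠ ∞ :=
    ENNReal.mul_ne_top (measure_ne_top _ _) (by finiteness)
  refine (ENNReal.add_le_add_iff_right hfinC).1 ?_
  calc _ = ∫⁻ ω in A, φ ω ∂P + ENNReal.ofReal (stopCoeff l b) * P A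
          + ∫⁻ ω in A, l * (ρ ω - σ ω) ∂P := by rw [add_right_comm, h6]; ring
    _ ≤ _ := add_le_add_left h5 _
    _ = _ := by rw [h7]; ring

end OneStepBounds

/-! ### Delays truncated at a horizon, and the area under the age curve. -/

section SamplePaths

variable {Ω : Type u} {N : ℝ≥0 → Ω → ℕ} {s : ℕ → Ω → ℝ≥0∞} {k : ℕ}

theorem battery_le (k : ℕ) (N : ℝ≥0 → Ω → ℕ) (s : ℕ → Ω → ℝ≥0∞) (n : ℕ) (ω : Ω) :
    battery k N s n ω ≤ k := by
  cases n with
  | zero => exact le_rfl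
  | succ n => exact min_le_right _ _

/-- Without `hT` all updates would fall by time `T`, and `ncard` of that infinite set would take its
default value `0`. -/
theorem le_numUpdates_iff {ω : Ω} (h0 : s 0 ω = 0) (hmono : Monotone fun n => s n ω) {T : ℝ≥0}
    (hT : ∃ n, (T : ℝ≥0∞) < s n ω) (n : ℕ) : s n ω ≤ T ↔ n ≤ numUpdates s T ω := by
  classical
  set M := Nat.find hT with hM
  have hMspec : (T : ℝ≥0∞) < s M ω := Nat.find_spec hT
  have hM0 : M ≠ 0 := by
    intro h
    rw [h, h0] at hMspec
    simp at hMspec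
  have hiff : ∀ n, s n ω ≤ T ↔ n ≤ M - 1 := by
    intro n
    constructor
    · intro h
      by_contra! h1
      exact absurd (hMspec.trans_le (hmono (show M ≤ n by omega))) (not_lt.2 h)
    · intro h
      exact not_lt.1 (Nat.find_min hT (show n < M by omega))
  have : {n : ℕ | 1 ≤ n ∧ s n ω ≤ T} = Set.Icc 1 (M - 1) := by
    ext n
    simp only [Set.mem_ofPred_eq, Set.mem_Icc, hiff]
  rw [hiff, numUpdates, this, Set.ncard_Icc_nat]
  simp

/-- The part of the `n`-th inter-update delay that lies before time `T`. -/
noncomputable def delayBefore (s : ℕ → Ω → ℝ≥0∞) (T : ℝ≥0) (n : ℕ) (ω : Ω) : ℝ≥0∞ :=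
  min (s (n + 1) ω) T - min (s n ω) T

theorem delayBefore_le (s : ℕ → Ω → ℝ≥0∞) (T : ℝ≥0) (n : ℕ) (ω : Ω) :
    delayBefore s T n ω ≤ T := tsub_le_self.trans (min_le_right _ _)

theorem delayBefore_eq_zero {T : ℝ≥0} {n : ℕ} {ω : Ω} (h : (T : ℝ≥0∞) ≤ s n ω) :
    delayBefore s T n ω = 0 := by
  unfold delayBefore
  rw [min_eq_right h]
  exact tsub_eq_zero_of_le (min_le_right _ _)

theorem delayBefore_le_step {T : ℝ≥0} {n : ℕ} {ω : Ω} (h : s n ω ≤ T) :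
    delayBefore s T n ω ≤ s (n + 1) ω - s n ω := by
  unfold delayBefore
  rw [min_eq_left h]
  exact tsub_le_tsub_right (min_le_left _ _) _

theorem sum_delayBefore {ω : Ω} (h0 : s 0 ω = 0) (hmono : ∀ n, s n ω ≤ s (n + 1) ω) (T : ℝ≥0)
    (m : ℕ) : ∑ n ∈ Finset.range m, delayBefore s T n ω = min (s m ω) T := by
  induction m with
  | zero => simp [h0]
  | succ m ih =>
    rw [Finset.sum_range_succ, ih, delayBefore]
    exact add_tsub_cancel_of_le (min_le_min_right _ (hmono m))

theorem sum_delayBefore_sq_le_ageArea {ω : Ω} (h0 : s 0 ω = 0) (hmono : Monotone fun n => s n ω)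
    {T : ℝ≥0} (hT : ∃ n, (T : ℝ≥0∞) < s n ω) (m : ℕ) :
    ∑ n ∈ Finset.range m, delayBefore s T n ω ^ 2 / 2 ≤ ageArea s T ω := by
  have hiff := le_numUpdates_iff h0 hmono hT
  set M := numUpdates s T ω with hM
  have h1 : ∑ n ∈ Finset.range m, delayBefore s T n ω ^ 2 / 2
      ≤ ∑ n ∈ Finset.range (M + 1), delayBefore s T n ω ^ 2 / 2 := by
    refine Finset.sum_le_sum_of_ne_zero fun n _ hne => ?_
    rw [Finset.mem_range]
    by_contra! hn
    refine hne ?_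
    rw [delayBefore_eq_zero]
    · simp
    · exact (not_le.1 fun h => absurd ((hiff n).1 h) (by omega)).le
  refine h1.trans ?_
  rw [Finset.sum_range_succ]
  simp only [ageArea]
  rw [← hM]
  gcongr ?_ + ?_ ^ 2 / 2
  · simp only [div_eq_mul_inv, Finset.sum_mul]
    gcongr with n hn
    exact delayBefore_le_step ((hiff n).2 (Finset.mem_range.1 hn).le)
  · unfold delayBefore
    rw [min_eq_left ((hiff M).2 le_rfl)]
    exact tsub_le_tsub_right (min_le_right _ _) _

/-- The relative value of the state right after the `n`-th update. -/
noncomputable def stateValue (l : ℝ) (k : ℕ) (N : ℝ≥0 → Ω → ℕ) (s : ℕ → Ω → ℝ≥0∞) (n : ℕ) (ω : Ω) :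
    ℝ≥0∞ :=
  ENNReal.ofReal (relValue l (battery k N s n ω - 1).toNat)

theorem exists_stateValue_le (l : ℝ) (k : ℕ) (N : ℝ≥0 → Ω → ℕ) (s : ℕ → Ω → ℝ≥0∞) :
    ∃ C : ℝ≥0, ∀ n ω, stateValue l k N s n ω ≤ C := by
  refine ⟨∑ b ∈ Finset.range (k + 1), (relValue l b).toNNReal, fun n ω => ?_⟩
  unfold stateValue ENNReal.ofReal
  rw [ENNReal.coe_le_coe]
  refine Finset.single_le_sum (f := fun b => (relValue l b).toNNReal) (fun _ _ => zero_le)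
    (Finset.mem_range.2 ?_)
  have := battery_le k N s n ω
  omega

theorem battery_succ_of_noArrival {n b : ℕ} {ω : Ω} (hb : battery k N s n ω = b + 1)
    (h : ω ∈ noArrival N (s n) (s (n + 1))) : battery k N s (n + 1) ω = b := by
  have h1 : N (s (n + 1) ω).toNNReal ω = N (s n ω).toNNReal ω := h
  have h2 := battery_le k N s n ω
  simp only [battery, arrivals, h1, hb]
  rw [Nat.sub_self, min_eq_left] <;> simp
  omega

end SamplePaths

/-! ### Energy balance along a policy. -/

section Battery

variable {Ω : Type u} [mΩ : MeasurableSpace Ω] {P : Measure Ω} {ℱ : Filtration ℝ≥0 mΩ}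
  {N : ℝ≥0 → Ω → ℕ} {s : ℕ → Ω → ℝ≥0∞} {k : ℕ}

theorem IsOnlinePolicy.step_le (hs : IsOnlinePolicy ℱ s) (n : ℕ) (ω : Ω) :
    s n ω ≤ s (n + 1) ω := hs.mono ω n.le_succ

theorem IsPoissonProcess.measurable_battery (hN : IsPoissonProcess P ℱ N)
    (hmono : ∀ n ω, s n ω ≤ s (n + 1) ω) (hst : ∀ n, IsStoppingTime ℱ (s n)) (n : ℕ) :
    Measurable[(hst n).measurableSpace] (battery k N s n) := by
  induction n with
  | zero => exact measurable_const
  | succ n ih =>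
    have h1 := measurable_mono_stoppingTime (hst n) (hst (n + 1)) (hmono n) ih
    have h2 := measurable_mono_stoppingTime (hst n) (hst (n + 1)) (hmono n)
      (hN.measurable_at_stoppingTime (hst n))
    have h3 := hN.measurable_at_stoppingTime (hst (n + 1))
    have h4 : Measurable fun p : ℤ × ℕ × ℕ => min (p.1 - 1 + k * ((p.2.1 - p.2.2 : ℕ) : ℤ)) (k : ℤ) :=
      Measurable.of_discrete
    exact h4.comp (h1.prodMk (h3.prodMk h2))

theorem IsPoissonProcess.battery_add_le (hN : IsPoissonProcess P ℱ N)
    (hs : IsOnlinePolicy ℱ s) (n : ℕ) (ω : Ω) (hfin : s n ω ≠ ∞) :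
    battery k N s n ω + n ≤ k + k * N (s n ω).toNNReal ω := by
  induction n with
  | zero =>
    simp only [battery]
    have : (0 : ℤ) ≤ k * N (s 0 ω).toNNReal ω := by positivity
    push_cast
    linarith
  | succ n ih =>
    have h1 := hs.step_le n ω
    have h2 := ih (ne_top_of_le_ne_top hfin h1)
    have h3 := hN.mono ω (ENNReal.toNNReal_mono hfin h1)
    simp only at h3
    have h4 : battery k N s (n + 1) ω
        ≤ battery k N s n ω - 1 + k * arrivals N (s n ω) (s (n + 1) ω) ω := min_le_left _ _
    unfold arrivals at h4
    rw [Nat.cast_sub h3] at h4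
    push_cast
    linarith

/-- The updates sent by time `T` are paid for by the initial `k` units and `k` more per arrival, so
a feasible path has only finitely many of them. -/
theorem IsPoissonProcess.exists_lt_of_forall_one_le_battery (hN : IsPoissonProcess P ℱ N)
    (hs : IsOnlinePolicy ℱ s) {ω : Ω} (hb : ∀ n, 1 ≤ battery k N s n ω) (T : ℝ≥0) :
    ∃ n, (T : ℝ≥0∞) < s n ω := by
  by_contra! h
  set n := k + k * N T ω
  have hfin : s n ω ≠ ∞ := ne_top_of_le_ne_top ENNReal.coe_ne_top (h n)
  have h1 := hN.battery_add_le hs (k := k) n ω hfin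
  have h2 := hb n
  have h3 := hN.mono ω (ENNReal.toNNReal_mono ENNReal.coe_ne_top (h n))
  simp only [ENNReal.toNNReal_coe] at h3
  have h4 : (k : ℤ) * N (s n ω).toNNReal ω ≤ k * N T ω := by gcongr
  have h5 : (n : ℤ) = k + k * N T ω := by simp [n]
  linarith

end Battery

/-! ### The optimality inequality for an arbitrary admissible policy. -/

section LowerBound

variable {Ω : Type u} [mΩ : MeasurableSpace Ω] {P : Measure Ω} {ℱ : Filtration ℝ≥0 mΩ}
  {N : ℝ≥0 → Ω → ℕ} {s : ℕ → Ω → ℝ≥0∞} {k : ℕ} {l : ℝ≥0}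

theorem measurable_stateValue (hN : IsPoissonProcess P ℱ N)
    (hmono : ∀ n ω, s n ω ≤ s (n + 1) ω) (hst : ∀ n, IsStoppingTime ℱ (s n)) (n : ℕ) :
    Measurable (stateValue l k N s n) := by
  have h1 := (hN.measurable_battery (k := k) hmono hst n).mono (hst n).measurableSpace_le le_rfl
  have h2 : Measurable fun b : ℤ => ENNReal.ofReal (relValue l (b - 1).toNat) := measurable_from_top
  exact h2.comp h1

/-- Feasibility confines the level before an update to `1, …, k` almost surely, so the comparison
may be made on each level separately. -/
theorem lintegral_le_of_battery (hN : IsPoissonProcess P ℱ N)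
    (hmono : ∀ n ω, s n ω ≤ s (n + 1) ω) (hst : ∀ n, IsStoppingTime ℱ (s n))
    (hfeas : IsFeasible P k N s) (T : ℝ≥0) (n : ℕ) {f g : Ω → ℝ≥0∞}
    (h : ∀ b, b ≤ k - 1 →
      ∫⁻ ω in {ω | s n ω ≤ T} ∩ {ω | battery k N s n ω = b + 1}, f ω ∂P
        ≤ ∫⁻ ω in {ω | s n ω ≤ T} ∩ {ω | battery k N s n ω = b + 1}, g ω ∂P) :
    ∫⁻ ω in {ω | s n ω ≤ T}, f ω ∂P ≤ ∫⁻ ω in {ω | s n ω ≤ T}, g ω ∂P := by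
  set B : ℕ → Set Ω := fun b => {ω | s n ω ≤ T} ∩ {ω | battery k N s n ω = b + 1} with hB
  have hsm := measurable_of_stoppingTime (hst n)
  have hbm := (hN.measurable_battery (k := k) hmono hst n).mono (hst n).measurableSpace_le le_rfl
  have hBm : ∀ b, MeasurableSet (B b) := fun b =>
    (measurableSet_le hsm measurable_const).inter (hbm (measurableSet_singleton _))
  have hd : Pairwise (Function.onFun Disjoint B) := by
    intro a b hab
    refine Set.disjoint_left.2 fun ω h1 h2 => hab ?_
    have := h1.2.symm.trans h2.2
    omega
  have hU : ({ω | s n ω ≤ T} : Set Ω) =ᵐ[P] (⋃ b, B b : Set Ω) := by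
    filter_upwards [hfeas] with ω hω
    refine propext ⟨fun h => Set.mem_iUnion.2 ⟨(battery k N s n ω - 1).toNat, h, ?_⟩,
      fun h => ?_⟩
    · have := hω n
      simp only [Set.mem_ofPred_eq]
      omega
    · obtain ⟨b, hb⟩ := Set.mem_iUnion.1 h
      exact hb.1
  rw [setLIntegral_congr hU, setLIntegral_congr hU, lintegral_iUnion hBm hd, lintegral_iUnion hBm hd]
  refine ENNReal.tsum_le_tsum fun b => ?_
  by_cases hb : b ≤ k - 1
  · exact h b hb
  · have : B b = ∅ := by
      ext ω
      simp only [hB, Set.mem_inter_iff, Set.mem_ofPred_eq, Set.mem_empty_iff_false, iff_false]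
      rintro ⟨-, h2⟩
      have := battery_le k N s n ω
      omega
    rw [this]
    simp

/-- Truncating at `T` keeps delays bounded, as the martingale identity requires. A delay completed
by `T` passes on the next relative value; the one in progress at `T` is charged `1` plus its
truncated length instead. -/
theorem lintegral_delayBefore_step [IsProbabilityMeasure P] (hN : IsPoissonProcess P ℱ N)
    (hl : IsCriticalRate k l) (hs : IsAdmissible P ℱ k N s) (T : ℝ≥0) (n : ℕ) :
    ∫⁻ ω, (l * delayBefore s T n ω + {ω | s n ω ≤ T}.indicator (stateValue l k N s n) ω) ∂P
      ≤ ∫⁻ ω, (delayBefore s T n ω ^ 2 / 2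
        + ({ω | s (n + 1) ω ≤ T}.indicator (stateValue l k N s (n + 1)) ω
          + ({ω | s n ω ≤ T} \ {ω | s (n + 1) ω ≤ T}).indicator
              (fun ω => 1 + delayBefore s T n ω) ω)) ∂P := by
  have hst := hs.online.stopping
  have hmono := fun n ω => hs.online.step_le n ω
  have hsm := fun n => measurable_of_stoppingTime (hst n)
  have hA : MeasurableSet {ω | s n ω ≤ T} := measurableSet_le (hsm n) measurable_const
  rw [← lintegral_add_compl _ hA]
  have h0 : ∫⁻ ω in {ω | s n ω ≤ T}ᶜ,
      (l * delayBefore s T n ω + {ω | s n ω ≤ T}.indicator (stateValue l k N s n) ω) ∂P = 0 := by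
    rw [setLIntegral_congr_fun (g := 0) hA.compl]
    · simp
    · intro ω hω
      have h1 : (T : ℝ≥0∞) ≤ s n ω := (not_le.1 (by exact hω)).le
      simp only [delayBefore_eq_zero h1, mul_zero, Set.indicator_of_notMem hω, add_zero,
        Pi.zero_apply]
  rw [h0, add_zero]
  refine le_trans ?_ (setLIntegral_le_lintegral {ω | s n ω ≤ T} _)
  refine lintegral_le_of_battery hN hmono hst hs.feasible T n fun b hb => ?_
  set σ : Ω → ℝ≥0∞ := fun ω => min (s n ω) T with hσdef
  set ρ : Ω → ℝ≥0∞ := fun ω => min (s (n + 1) ω) T with hρdef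
  have hσ : IsStoppingTime ℱ σ := (hst n).min_const T
  have hρ : IsStoppingTime ℱ ρ := (hst (n + 1)).min_const T
  have hAb : MeasurableSet[hσ.measurableSpace]
      ({ω | s n ω ≤ T} ∩ {ω | battery k N s n ω = b + 1}) := by
    rw [Set.inter_comm]
    refine (IsStoppingTime.measurableSet_inter_le_const_iff (hst n) _ T).1 ?_
    exact MeasurableSet.inter
      (hN.measurable_battery hmono hst n (measurableSet_singleton ((b : ℤ) + 1)))
      ((hst n).measurableSet_le' T)
  have key := hN.lintegral_step_ge hσ hρ (fun ω => min_le_min_right _ (hmono n ω)) hAb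
    (fun ω _ => ne_top_of_le_ne_top ENNReal.coe_ne_top (min_le_right _ _)) (K := T)
    (fun ω _ => delayBefore_le s T n ω) (hl.nonneg b hb)
    (Z := fun ω => {ω | s (n + 1) ω ≤ T}.indicator (stateValue l k N s (n + 1)) ω
          + ({ω | s n ω ≤ T} \ {ω | s (n + 1) ω ≤ T}).indicator
              (fun ω => 1 + delayBefore s T n ω) ω) ?_
  · refine le_trans (le_of_eq ?_) key
    refine setLIntegral_congr_fun (hσ.measurableSpace_le _ hAb) fun ω hω => ?_
    rw [Set.indicator_of_mem hω.1, stateValue, hω.2]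
    simp [delayBefore, σ, ρ]
  · filter_upwards [hs.feasible] with ω hfe hω hno
    have h1 : s n ω ≤ T := hω.1
    have h2 : battery k N s n ω = b + 1 := hω.2
    have hx0 : 0 ≤ (ρ ω - σ ω).toReal := ENNReal.toReal_nonneg
    by_cases h3 : s (n + 1) ω ≤ T
    · have hno' : ω ∈ noArrival N (s n) (s (n + 1)) := by
        unfold noArrival at hno ⊢
        simpa only [hσdef, hρdef, Set.mem_ofPred_eq, min_eq_left h3, min_eq_left h1] using hno
      have h4 := battery_succ_of_noArrival h2 hno'
      have h5 := hfe (n + 1)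
      rw [h4] at h5
      -- Without an arrival the next update finds exactly `b` units, so feasibility forces `b ≥ 1`.
      obtain ⟨b', rfl⟩ : ∃ b', b = b' + 1 := ⟨b - 1, by omega⟩
      rw [Set.indicator_of_mem (by exact h3), Set.indicator_of_notMem (by simp [h3]), add_zero,
        stateValue, h4]
      have hh := hl.nonneg b' (by omega)
      have e1 : (((b' + 1 : ℕ) : ℤ) - 1).toNat = b' := by omega
      rw [e1, ← ENNReal.ofReal_mul (stopCoeff_nonneg _ _), ← ENNReal.ofReal_add (by positivity) hh,
        ← ENNReal.ofReal_add (by positivity) (mul_nonneg (stopCoeff_nonneg _ _) (by positivity))]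
      refine ENNReal.ofReal_le_ofReal ((expectedExcess_le_stop _ hh).trans (le_of_eq ?_))
      simp only [stopCoeff]
      rw [sub_eq_add_neg _ (l : ℝ), Real.exp_add]
      ring
    · rw [Set.indicator_of_notMem (by simpa using h3), Set.indicator_of_mem (by exact ⟨h1, h3⟩),
        zero_add]
      refine le_trans ?_ le_self_add
      have hfin : ρ ω - σ ω ≠ ∞ :=
        ne_top_of_le_ne_top ENNReal.coe_ne_top (delayBefore_le s T n ω)
      have e1 : 1 + delayBefore s T n ω
          = ENNReal.ofReal (1 + (ρ ω - σ ω).toReal) := by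
        rw [ENNReal.ofReal_add zero_le_one hx0, ENNReal.ofReal_one, ENNReal.ofReal_toReal hfin]
        rfl
      rw [e1, ← ENNReal.ofReal_add (by positivity) (by positivity)]
      exact ENNReal.ofReal_le_ofReal (expectedExcess_le_wait hx0 l.coe_nonneg)

end LowerBound

/-! ### The delay in progress at the horizon. -/

section CurrentDelay

variable {Ω : Type u} {s : ℕ → Ω → ℝ≥0∞}

theorem le_mul_sq_half_add {X : ℝ≥0∞} (hX : X ≠ ∞) {d : ℝ≥0} (hd : 0 < d) :
    X ≤ d * (X ^ 2 / 2) + (1 / (2 * d) : ℝ≥0) := by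
  lift X to ℝ≥0 using hX
  have h1 : (X : ℝ≥0∞) ^ 2 / 2 = ((X ^ 2 / 2 : ℝ≥0) : ℝ≥0∞) := by
    rw [ENNReal.coe_div (by norm_num)]; simp
  rw [h1, ← ENNReal.coe_mul, ← ENNReal.coe_add, ENNReal.coe_le_coe, ← NNReal.coe_le_coe]
  push_cast
  have hd' : (0 : ℝ) < d := hd
  have : (d : ℝ) * ((X : ℝ) ^ 2 / 2) + 1 / (2 * d) - X = (d * X - 1) ^ 2 / (2 * d) := by
    field_simp
    ring
  have h2 : 0 ≤ ((d : ℝ) * X - 1) ^ 2 / (2 * d) := by positivity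
  linarith

theorem sum_indicator_current {ω : Ω} (h0 : s 0 ω = 0) (hmono : ∀ n, s n ω ≤ s (n + 1) ω) (T : ℝ≥0)
    (m : ℕ) :
    ∑ n ∈ Finset.range m, ({ω | s n ω ≤ T} \ {ω | s (n + 1) ω ≤ T}).indicator (1 : Ω → ℝ≥0∞) ω
      = {ω | s m ω ≤ T}ᶜ.indicator 1 ω := by
  induction m with
  | zero => simp [h0]
  | succ m ih =>
    rw [Finset.sum_range_succ, ih]
    have := hmono m
    by_cases h1 : s m ω ≤ T <;> by_cases h2 : s (m + 1) ω ≤ T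
    · simp [h1, h2]
    · simp [h1, h2]
    · exact absurd (this.trans h2) h1
    · simp [h1, h2]

/-- At most one delay is in progress at `T`. By the inequality of arithmetic and geometric means its
length costs an arbitrarily small fraction `d` of the area plus a constant independent of `T`. -/
theorem sum_current_delay_le {ω : Ω} (h0 : s 0 ω = 0) (hmono : ∀ n, s n ω ≤ s (n + 1) ω) (T : ℝ≥0)
    (m : ℕ) {d : ℝ≥0} (hd : 0 < d) :
    ∑ n ∈ Finset.range m, ({ω | s n ω ≤ T} \ {ω | s (n + 1) ω ≤ T}).indicator
        (fun ω => 1 + delayBefore s T n ω) ω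
      ≤ d * ∑ n ∈ Finset.range m, delayBefore s T n ω ^ 2 / 2 + (1 + (1 / (2 * d) : ℝ≥0)) := by
  have h1 : ∀ n, ({ω | s n ω ≤ T} \ {ω | s (n + 1) ω ≤ T}).indicator
        (fun ω => 1 + delayBefore s T n ω) ω
      ≤ d * (delayBefore s T n ω ^ 2 / 2) + (1 + (1 / (2 * d) : ℝ≥0)) *
        ({ω | s n ω ≤ T} \ {ω | s (n + 1) ω ≤ T}).indicator (1 : Ω → ℝ≥0∞) ω := by
    intro n
    by_cases h : ω ∈ ({ω | s n ω ≤ T} \ {ω | s (n + 1) ω ≤ T})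
    · rw [Set.indicator_of_mem h, Set.indicator_of_mem h]
      have := le_mul_sq_half_add
        (ne_top_of_le_ne_top ENNReal.coe_ne_top (delayBefore_le s T n ω)) hd
      calc _ ≤ 1 + (_ + _) := add_le_add_right this 1
        _ = _ := by simp only [Pi.one_apply]; ring
    · rw [Set.indicator_of_notMem h]
      exact zero_le
  refine (Finset.sum_le_sum fun n _ => h1 n).trans ?_
  rw [Finset.sum_add_distrib, ← Finset.mul_sum, ← Finset.mul_sum, sum_indicator_current h0 hmono]
  gcongr
  refine mul_le_of_le_one_right' ?_
  exact Set.indicator_le_self' (fun _ _ => zero_le) ω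

end CurrentDelay

/-! ### The lower bound on the average age. -/

section LowerBoundAverage

variable {Ω : Type u} [mΩ : MeasurableSpace Ω] {P : Measure Ω} {ℱ : Filtration ℝ≥0 mΩ}
  {N : ℝ≥0 → Ω → ℕ} {s : ℕ → Ω → ℝ≥0∞} {k : ℕ} {l : ℝ≥0}

theorem measurable_delayBefore (hsm : ∀ n, Measurable (s n)) (T : ℝ≥0) (n : ℕ) :
    Measurable (delayBefore s T n) :=
  ((hsm (n + 1)).min measurable_const).sub ((hsm n).min measurable_const)

theorem lintegral_ageArea_ge [IsProbabilityMeasure P] (hN : IsPoissonProcess P ℱ N)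
    (hl : IsCriticalRate k l) (hs : IsAdmissible P ℱ k N s) {d : ℝ≥0} (hd : 0 < d) :
    ∃ C : ℝ≥0, ∀ T : ℝ≥0, (l : ℝ≥0∞) * T ≤ (1 + d) * ∫⁻ ω, ageArea s T ω ∂P + C := by
  obtain ⟨C, hC⟩ := exists_stateValue_le l k N s
  refine ⟨C + (1 + 1 / (2 * d)), fun T => ?_⟩
  have hst := hs.online.stopping
  have hmono := fun n ω => hs.online.step_le n ω
  have hsm := fun n => measurable_of_stoppingTime (hst n)
  have hdm := measurable_delayBefore hsm T
  have hVm := measurable_stateValue (l := l) (k := k) hN hmono hst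
  have hAm : ∀ n, MeasurableSet {ω | s n ω ≤ T} := fun n => measurableSet_le (hsm n) measurable_const
  have hIm : ∀ n, Measurable ({ω | s n ω ≤ T}.indicator (stateValue l k N s n)) :=
    fun n => (hVm n).indicator (hAm n)
  set v : ℕ → ℝ≥0∞ := fun n => ∫⁻ ω, {ω | s n ω ≤ T}.indicator (stateValue l k N s n) ω ∂P with hv
  have hvC : ∀ n, v n ≤ C := by
    intro n
    calc v n ≤ ∫⁻ _, C ∂P := by
          refine lintegral_mono fun ω => ?_
          exact (Set.indicator_le_self' (fun _ _ => zero_le) ω).trans (hC n ω)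
      _ = C := by simp
  have hstep : ∀ n, ∫⁻ ω, l * delayBefore s T n ω ∂P + v n
      ≤ ∫⁻ ω, delayBefore s T n ω ^ 2 / 2 ∂P + (v (n + 1)
        + ∫⁻ ω, ({ω | s n ω ≤ T} \ {ω | s (n + 1) ω ≤ T}).indicator
              (fun ω => 1 + delayBefore s T n ω) ω ∂P) := by
    intro n
    have := lintegral_delayBefore_step hN hl hs T n
    rwa [lintegral_add_right _ (hIm n), lintegral_add_left ((hdm n).pow_const 2 |>.div_const 2),
      lintegral_add_left (hIm (n + 1))] at this
  have hsum : ∀ m, l * ∫⁻ ω, min (s m ω) T ∂P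
      ≤ (1 + d) * ∫⁻ ω, ageArea s T ω ∂P + (C + (1 + 1 / (2 * d)) : ℝ≥0) := by
    intro m
    have h1 := Finset.sum_le_sum fun n (_ : n ∈ Finset.range m) => hstep n
    simp only [Finset.sum_add_distrib] at h1
    rw [← lintegral_finsetSum _ (fun n _ => (hdm n).const_mul _),
      ← lintegral_finsetSum _ (fun n _ => (hdm n).pow_const 2 |>.div_const 2),
      ← lintegral_finsetSum _ (fun n _ => ((hdm n).const_add 1).indicator
        ((hAm n).diff (hAm (n + 1))))] at h1
    simp only [← Finset.mul_sum, sum_delayBefore (hs.online.zero _) (fun n => hmono n _)] at h1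
    rw [lintegral_const_mul _ ((hsm m).min measurable_const)] at h1
    -- The relative values telescope up to the boundary term `v m ≤ C`, and their common finite sum
    -- cancels.
    have h2 : ∑ n ∈ Finset.range m, v (n + 1) ≤ ∑ n ∈ Finset.range m, v n + C := by
      calc _ ≤ ∑ n ∈ Finset.range m, v (n + 1) + v 0 := le_self_add
        _ = ∑ n ∈ Finset.range m, v n + v m := by
          rw [← Finset.sum_range_succ', Finset.sum_range_succ]
        _ ≤ _ := by gcongr; exact hvC m
    have hfin : ∑ n ∈ Finset.range m, v n ≠ ∞ :=
      ENNReal.sum_ne_top.2 fun n _ => ne_top_of_le_ne_top ENNReal.coe_ne_top (hvC n)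
    have h3 : ∫⁻ ω, ∑ n ∈ Finset.range m, delayBefore s T n ω ^ 2 / 2 ∂P
        ≤ ∫⁻ ω, ageArea s T ω ∂P := by
      refine lintegral_mono_ae ?_
      filter_upwards [hs.feasible] with ω hω
      exact sum_delayBefore_sq_le_ageArea (hs.online.zero ω) (hs.online.mono ω)
        (hN.exists_lt_of_forall_one_le_battery hs.online hω T) m
    have h4 : ∫⁻ ω, ∑ n ∈ Finset.range m, ({ω | s n ω ≤ T} \ {ω | s (n + 1) ω ≤ T}).indicator
          (fun ω => 1 + delayBefore s T n ω) ω ∂P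
        ≤ d * ∫⁻ ω, ageArea s T ω ∂P + (1 + (1 / (2 * d) : ℝ≥0)) := by
      calc _ ≤ ∫⁻ ω, (d * ∑ n ∈ Finset.range m, delayBefore s T n ω ^ 2 / 2
            + (1 + (1 / (2 * d) : ℝ≥0))) ∂P :=
            lintegral_mono fun ω =>
              sum_current_delay_le (hs.online.zero ω) (fun n => hmono n ω) T m hd
        _ = d * ∫⁻ ω, ∑ n ∈ Finset.range m, delayBefore s T n ω ^ 2 / 2 ∂P
            + (1 + (1 / (2 * d) : ℝ≥0)) := by
            rw [lintegral_add_right _ measurable_const, lintegral_const_mul' _ _ ENNReal.coe_ne_top]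
            simp
        _ ≤ _ := by gcongr
    refine (ENNReal.add_le_add_iff_right hfin).1 ?_
    calc _ ≤ _ := h1
      _ ≤ ∫⁻ ω, ageArea s T ω ∂P + ((∑ n ∈ Finset.range m, v n + C)
          + (d * ∫⁻ ω, ageArea s T ω ∂P + (1 + (1 / (2 * d) : ℝ≥0)))) := by
          gcongr
      _ = _ := by push_cast; ring
  -- The truncated delays add up to `min (s m) T`, which equals `T` for all large `m` on every
  -- feasible path.
  have hlim : Tendsto (fun m => ∫⁻ ω, min (s m ω) T ∂P) atTop (nhds (∫⁻ _, T ∂P)) := by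
    refine lintegral_tendsto_of_tendsto_of_monotone
      (fun m => ((hsm m).min measurable_const).aemeasurable) ?_ ?_
    · exact ae_of_all _ fun ω a b hab => min_le_min_right _ (hs.online.mono ω hab)
    · filter_upwards [hs.feasible] with ω hω
      obtain ⟨M, hM⟩ := hN.exists_lt_of_forall_one_le_battery hs.online hω T
      refine tendsto_const_nhds.congr' ?_
      filter_upwards [eventually_ge_atTop M] with m hm
      exact (min_eq_right (hM.le.trans (hs.online.mono ω hm))).symm
  simp only [lintegral_const, measure_univ, mul_one] at hlim
  exact le_of_tendsto' (ENNReal.Tendsto.const_mul hlim (Or.inr ENNReal.coe_ne_top)) hsum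

/-- No admissible policy has a long term average age below the critical rate. -/
theorem le_averageAge [IsProbabilityMeasure P] (hN : IsPoissonProcess P ℱ N)
    (hl : IsCriticalRate k l) (hs : IsAdmissible P ℱ k N s) : (l : ℝ≥0∞) ≤ averageAge P s := by
  by_contra! h
  obtain ⟨q, hq1, hq2⟩ := ENNReal.lt_iff_exists_nnreal_btwn.1 h
  have hql : q < l := ENNReal.coe_lt_coe.1 hq2
  have hev := Filter.eventually_lt_of_limsup_lt hq1
  -- Small enough for `(1 + d) * q < l`, so that the bound fails for large `T` if the average age is
  -- below `q`.
  set d : ℝ≥0 := (l - q) / (2 * (q + 1)) with hd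
  have hd0 : 0 < d := div_pos (tsub_pos_of_lt hql) (by positivity)
  obtain ⟨C, hC⟩ := lintegral_ageArea_ge hN hl hs hd0
  have hdq : (1 + d) * q < l := by
    rw [← NNReal.coe_lt_coe, hd]
    push_cast [NNReal.coe_sub hql.le]
    have h1 : (0 : ℝ) < l - q := sub_pos.2 hql
    have h2 : ((l : ℝ) - q) / (2 * (q + 1)) * q < l - q := by
      rw [div_mul_eq_mul_div, div_lt_iff₀ (by positivity)]
      nlinarith [q.coe_nonneg]
    linarith
  have hlarge := eventually_gt_atTop (C / (l - (1 + d) * q))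
  obtain ⟨T, ⟨hT1, hT2⟩, hT0⟩ := ((hev.and hlarge).and (eventually_gt_atTop 0)).exists
  have hT0' : (T : ℝ≥0∞) ≠ 0 := by simpa using hT0.ne'
  have h1 : ∫⁻ ω, ageArea s T ω ∂P ≤ q * T :=
    (ENNReal.div_le_iff hT0' ENNReal.coe_ne_top).1 hT1.le
  have h2 : (l : ℝ≥0∞) * T ≤ (1 + d) * (q * T) + C := (hC T).trans (by gcongr)
  have h3 : l * T ≤ (1 + d) * (q * T) + C := by exact_mod_cast h2
  rw [div_lt_iff₀ (tsub_pos_of_lt hdq)] at hT2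
  rw [← NNReal.coe_le_coe] at h3
  rw [← NNReal.coe_lt_coe] at hT2
  push_cast [NNReal.coe_sub hdq.le] at h3 hT2
  linarith

end LowerBoundAverage

/-! ### The threshold policy. -/

section Threshold

/-- The age at which a sensor with `b` units left updates without a new arrival. -/
noncomputable def threshold (l : ℝ≥0) : ℕ → ℝ≥0∞
  | 0 => ∞
  | b + 1 => (l + (relValue l b).toNNReal : ℝ≥0)

theorem le_threshold (l : ℝ≥0) (b : ℕ) : (l : ℝ≥0∞) ≤ threshold l b := by
  cases b with
  | zero => exact le_top
  | succ b => simp only [threshold, ENNReal.coe_le_coe]; exact le_self_add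

/-- The pair of the time of the `n`-th update and the battery level just before it, for the policy
that updates when the age reaches the threshold of the current battery level, or at age at least
`l` after an arrival. -/
noncomputable def policyState {Ω : Type u} (k : ℕ) (l : ℝ≥0) (N : ℝ≥0 → Ω → ℕ) (ω : Ω) :
    ℕ → ℝ≥0∞ × ℤ
  | 0 => (0, k)
  | n + 1 =>
    let t := (policyState k l N ω n).1
    let b := (policyState k l N ω n).2
    let t' := t + min (threshold l (b - 1).toNat) (max (timeToArrival N t ω) l)
    (t', min (b - 1 + k * arrivals N t t' ω) k)

/-- The threshold policy. -/
noncomputable def thresholdPolicy {Ω : Type u} (k : ℕ) (l : ℝ≥0) (N : ℝ≥0 → Ω → ℕ) (n : ℕ)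
    (ω : Ω) : ℝ≥0∞ :=
  (policyState k l N ω n).1

/-- The battery level left by the `n`-th update. -/
noncomputable def levelAfter {Ω : Type u} (k : ℕ) (N : ℝ≥0 → Ω → ℕ) (s : ℕ → Ω → ℝ≥0∞) (n : ℕ)
    (ω : Ω) : ℕ :=
  (battery k N s n ω - 1).toNat

variable {Ω : Type u} {k : ℕ} {l : ℝ≥0} {N : ℝ≥0 → Ω → ℕ}

theorem battery_thresholdPolicy (n : ℕ) (ω : Ω) :
    battery k N (thresholdPolicy k l N) n ω = (policyState k l N ω n).2 := by
  induction n with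
  | zero => rfl
  | succ n ih => simp only [battery, ih]; rfl

theorem thresholdPolicy_zero (ω : Ω) : thresholdPolicy k l N 0 ω = 0 := rfl

theorem thresholdPolicy_succ (n : ℕ) (ω : Ω) :
    thresholdPolicy k l N (n + 1) ω = thresholdPolicy k l N n ω
      + min (threshold l (levelAfter k N (thresholdPolicy k l N) n ω))
          (max (timeToArrival N (thresholdPolicy k l N n ω) ω) l) := by
  rw [levelAfter, battery_thresholdPolicy]
  rfl

theorem thresholdPolicy_step (n : ℕ) (ω : Ω) :
    thresholdPolicy k l N n ω ≤ thresholdPolicy k l N (n + 1) ω := by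
  rw [thresholdPolicy_succ]
  exact le_self_add

theorem thresholdPolicy_mono (ω : Ω) : Monotone fun n => thresholdPolicy k l N n ω :=
  monotone_nat_of_le_succ fun n => thresholdPolicy_step n ω

theorem thresholdPolicy_sub_le (n : ℕ) (ω : Ω) :
    thresholdPolicy k l N (n + 1) ω - thresholdPolicy k l N n ω
      ≤ max (timeToArrival N (thresholdPolicy k l N n ω) ω) l := by
  rw [thresholdPolicy_succ, tsub_le_iff_left]
  gcongr
  exact min_le_right _ _

theorem battery_succ_of_arrival {s : ℕ → Ω → ℝ≥0∞} {n : ℕ} {ω : Ω} (hb : 1 ≤ battery k N s n ω)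
    (h : N (s n ω).toNNReal ω < N (s (n + 1) ω).toNNReal ω) : battery k N s (n + 1) ω = k := by
  simp only [battery, arrivals]
  refine min_eq_right ?_
  have h1 : 1 ≤ N (s (n + 1) ω).toNNReal ω - N (s n ω).toNNReal ω := by omega
  have h2 : (k : ℤ) * 1 ≤ k * ((N (s (n + 1) ω).toNNReal ω - N (s n ω).toNNReal ω : ℕ) : ℤ) := by
    gcongr
    exact_mod_cast h1
  linarith

end Threshold

/-! ### Admissibility of the threshold policy. -/

section ThresholdPolicy

variable {Ω : Type u} [mΩ : MeasurableSpace Ω] {P : Measure Ω} {ℱ : Filtration ℝ≥0 mΩ}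
  {N : ℝ≥0 → Ω → ℕ} {σ : Ω → ℝ≥0∞} {k : ℕ} {l : ℝ≥0}

/-- The event `σ + X ≤ t` is known at `σ` and lies in `{σ ≤ t}`, hence belongs to `ℱ t`. -/
theorem isStoppingTime_add (hσ : IsStoppingTime ℱ σ) {X : Ω → ℝ≥0∞}
    (hX : Measurable[hσ.measurableSpace] X) : IsStoppingTime ℱ (fun ω => σ ω + X ω) := by
  intro t
  have h : Measurable[hσ.measurableSpace] fun ω => σ ω + X ω := (measurable_stoppingTime hσ).add hX
  have h1 := measurableSet_inter_le_coe hσ (h (measurableSet_Iic (a := (t : ℝ≥0∞)))) t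
  convert h1 using 1
  ext ω
  constructor
  · intro h2
    exact ⟨h2, le_trans (le_self_add (a := σ ω) (b := X ω)) h2⟩
  · exact fun h2 => h2.1

/-- The first arrival after a stopping time is a stopping time. -/
theorem IsPoissonProcess.isStoppingTime_nextArrival (hN : IsPoissonProcess P ℱ N)
    (hσ : IsStoppingTime ℱ σ) :
    IsStoppingTime ℱ (fun ω => σ ω + timeToArrival N (σ ω) ω) := by
  intro t
  -- The next arrival has come by `t` exactly when the count at `t` exceeds the count `c` at `σ`;
  -- the union runs over the possible values of `c`.
  have h1 : MeasurableSet[ℱ t] (⋃ c : ℕ,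
      (((fun ω => N (σ ω).toNNReal ω) ⁻¹' {c}) ∩ {ω | σ ω ≤ t}) ∩ (N t ⁻¹' Set.Ioi c)) :=
    MeasurableSet.iUnion fun c => MeasurableSet.inter
      (measurableSet_inter_le_coe hσ (hN.measurable_at_stoppingTime hσ (measurableSet_singleton c)) t)
      (hN.adapted t measurableSet_Ioi)
  convert h1 using 1
  ext ω
  simp only [Set.mem_iUnion, Set.mem_inter_iff, Set.mem_preimage, Set.mem_singleton_iff,
    Set.mem_Ioi, Set.mem_ofPred_eq]
  have key : ∀ h : σ ω ≤ t, (σ ω + timeToArrival N (σ ω) ω ≤ t ↔ N (σ ω).toNNReal ω < N t ω) := by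
    intro h
    have hf : σ ω ≠ ∞ := ne_top_of_le_ne_top ENNReal.coe_ne_top h
    lift σ ω to ℝ≥0 using hf with a
    obtain ⟨v, rfl⟩ := exists_add_of_le (ENNReal.coe_le_coe.1 h)
    rw [ENNReal.coe_add, ENNReal.add_le_add_iff_left ENNReal.coe_ne_top,
      hN.timeToArrival_le_coe_iff]
    rfl
  constructor
  · intro h
    have h2 : σ ω ≤ t := le_self_add.trans h
    exact ⟨_, ⟨rfl, h2⟩, (key h2).1 h⟩
  · rintro ⟨c, ⟨rfl, h2⟩, h3⟩
    exact (key h2).2 h3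

theorem IsPoissonProcess.isStoppingTime_thresholdPolicy (hN : IsPoissonProcess P ℱ N) (n : ℕ) :
    IsStoppingTime ℱ (thresholdPolicy k l N n) ∧ ∀ h : IsStoppingTime ℱ (thresholdPolicy k l N n),
      Measurable[h.measurableSpace] (battery k N (thresholdPolicy k l N) n) := by
  induction n with
  | zero => exact ⟨isStoppingTime_const ℱ 0, fun h => measurable_const⟩
  | succ n ih =>
    obtain ⟨hσ, hb⟩ := ih
    have hb := hb hσ
    have hst : IsStoppingTime ℱ (thresholdPolicy k l N (n + 1)) := by
      have h1 : IsStoppingTime ℱ (fun ω => thresholdPolicy k l N n ω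
          + threshold l (levelAfter k N (thresholdPolicy k l N) n ω)) := by
        refine isStoppingTime_add hσ ?_
        have : Measurable fun b : ℤ => threshold l (b - 1).toNat := Measurable.of_discrete
        exact this.comp hb
      have h2 := hN.isStoppingTime_nextArrival hσ
      have h3 : IsStoppingTime ℱ (fun ω => thresholdPolicy k l N n ω + (l : ℝ≥0∞)) :=
        isStoppingTime_add hσ measurable_const
      have hdist : ∀ a b c d : ℝ≥0∞, a + min b (max c d) = min (a + b) (max (a + c) (a + d)) := by
        intro a b c d
        rw [max_add_add_left, min_add_add_left]
      refine (congrArg (IsStoppingTime ℱ) (funext fun ω => ?_)).mpr (h1.min (h2.max h3))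
      rw [thresholdPolicy_succ]
      exact hdist _ _ _ _
    refine ⟨hst, fun h => ?_⟩
    have h1 := measurable_mono_stoppingTime hσ h (thresholdPolicy_step n) hb
    have h2 := measurable_mono_stoppingTime hσ h (thresholdPolicy_step n)
      (hN.measurable_at_stoppingTime hσ)
    have h3 := hN.measurable_at_stoppingTime h
    have h4 : Measurable fun p : ℤ × ℕ × ℕ => min (p.1 - 1 + k * ((p.2.1 - p.2.2 : ℕ) : ℤ)) (k : ℤ) :=
      Measurable.of_discrete
    exact h4.comp (h1.prodMk (h3.prodMk h2))

theorem IsPoissonProcess.isOnlinePolicy_thresholdPolicy (hN : IsPoissonProcess P ℱ N) :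
    IsOnlinePolicy ℱ (thresholdPolicy k l N) where
  zero := thresholdPolicy_zero
  mono := thresholdPolicy_mono
  stopping n := (hN.isStoppingTime_thresholdPolicy n).1

theorem IsPoissonProcess.ae_timeToArrival_ne_top_of_ae [IsProbabilityMeasure P]
    (hN : IsPoissonProcess P ℱ N) (hσ : IsStoppingTime ℱ σ) (hfin : ∀ᵐ ω ∂P, σ ω ≠ ∞) :
    ∀ᵐ ω ∂P, timeToArrival N (σ ω) ω ≠ ∞ := by
  have hA : MeasurableSet[hσ.measurableSpace] {ω | σ ω ≠ ∞} :=
    measurable_stoppingTime hσ (measurableSet_singleton ∞).compl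
  have h := hN.ae_timeToArrival_ne_top hσ hA (fun ω hω => hω)
  rw [ae_restrict_iff' (hσ.measurableSpace_le _ hA)] at h
  filter_upwards [h, hfin] with ω h1 h2
  exact h1 h2

theorem IsPoissonProcess.lintegral_timeToArrival_of_ae [IsProbabilityMeasure P]
    (hN : IsPoissonProcess P ℱ N) (hσ : IsStoppingTime ℱ σ) (hfin : ∀ᵐ ω ∂P, σ ω ≠ ∞)
    {f : ℝ → ℝ≥0∞} (hf : Measurable f) :
    ∫⁻ ω, f (timeToArrival N (σ ω) ω).toReal ∂P = ∫⁻ v, f v ∂expMeasure 1 := by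
  have hA : MeasurableSet[hσ.measurableSpace] {ω | σ ω ≠ ∞} :=
    measurable_stoppingTime hσ (measurableSet_singleton ∞).compl
  have h := hN.lintegral_timeToArrival hσ hA (fun ω hω => hω) (X := fun _ => (0 : ℝ))
    measurable_const (f := fun _ v => f v) (hf.comp measurable_snd)
  have hU : ({ω | σ ω ≠ ∞} : Set Ω) =ᵐ[P] Set.univ := by
    filter_upwards [hfin] with ω h1
    exact propext ⟨fun _ => trivial, fun _ => h1⟩
  simpa [setLIntegral_congr hU] using h

theorem IsPoissonProcess.lintegral_add_timeToArrival_sq [IsProbabilityMeasure P]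
    (hN : IsPoissonProcess P ℱ N) (hσ : IsStoppingTime ℱ σ) (hfin : ∀ᵐ ω ∂P, σ ω ≠ ∞) (a : ℝ≥0) :
    ∫⁻ ω, (a + timeToArrival N (σ ω) ω) ^ 2 / 2 ∂P = ENNReal.ofReal (expectedExcess a) := by
  rw [← lintegral_excess, ← hN.lintegral_timeToArrival_of_ae hσ hfin
    (f := fun v => ENNReal.ofReal ((max ((a : ℝ) + v) 0) ^ 2 / 2)) (by fun_prop)]
  refine lintegral_congr_ae ?_
  filter_upwards [hN.ae_timeToArrival_ne_top_of_ae hσ hfin] with ω hω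
  lift timeToArrival N (σ ω) ω to ℝ≥0 using hω with v
  have h0 : (0 : ℝ) ≤ (a : ℝ) + v := by positivity
  rw [ENNReal.coe_toReal, max_eq_left h0, ENNReal.ofReal_div_of_pos (by norm_num),
    ENNReal.ofReal_pow h0, ENNReal.ofReal_add a.coe_nonneg v.coe_nonneg]
  simp

theorem IsPoissonProcess.ae_thresholdPolicy_ne_top [IsProbabilityMeasure P]
    (hN : IsPoissonProcess P ℱ N) : ∀ᵐ ω ∂P, ∀ n, thresholdPolicy k l N n ω ≠ ∞ := by
  rw [ae_all_iff]
  intro n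
  induction n with
  | zero => exact ae_of_all _ fun ω => by simp [thresholdPolicy_zero]
  | succ n ih =>
    filter_upwards [ih, hN.ae_timeToArrival_ne_top_of_ae
      (hN.isStoppingTime_thresholdPolicy n).1 ih] with ω h1 h2
    rw [thresholdPolicy_succ]
    refine ENNReal.add_ne_top.2 ⟨h1, ne_top_of_le_ne_top ?_ (min_le_right _ _)⟩
    exact max_ne_top h2 ENNReal.coe_ne_top

theorem IsPoissonProcess.ae_timeToArrival_thresholdPolicy_ne_top [IsProbabilityMeasure P]
    (hN : IsPoissonProcess P ℱ N) :
    ∀ᵐ ω ∂P, ∀ n, timeToArrival N (thresholdPolicy k l N n ω) ω ≠ ∞ := by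
  rw [ae_all_iff]
  exact fun n => hN.ae_timeToArrival_ne_top_of_ae (hN.isStoppingTime_thresholdPolicy n).1
    ((ae_all_iff.1 hN.ae_thresholdPolicy_ne_top) n)

/-- An arrival occurs in the interval between consecutive updates exactly when the waiting time
is at most the inter-update delay. -/
theorem IsPoissonProcess.lt_iff_timeToArrival_le (hN : IsPoissonProcess P ℱ N) {t x : ℝ≥0∞}
    {ω : Ω} (ht : t ≠ ∞) (hx : x ≠ ∞) :
    N t.toNNReal ω < N (t + x).toNNReal ω ↔ timeToArrival N t ω ≤ x := by
  lift t to ℝ≥0 using ht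
  lift x to ℝ≥0 using hx
  rw [hN.timeToArrival_le_coe_iff]
  rfl

/-- With one unit before an update the battery is left empty, its threshold is infinite, and the
policy waits for an arrival. -/
theorem IsPoissonProcess.one_le_battery_thresholdPolicy (hN : IsPoissonProcess P ℱ N) (hk : 1 ≤ k)
    {ω : Ω} (h1 : ∀ n, thresholdPolicy k l N n ω ≠ ∞)
    (h2 : ∀ n, timeToArrival N (thresholdPolicy k l N n ω) ω ≠ ∞) (n : ℕ) :
    1 ≤ battery k N (thresholdPolicy k l N) n ω := by
  induction n with
  | zero => simpa [battery] using hk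
  | succ n ih =>
    rcases ih.eq_or_lt with h | h
    · have hx := thresholdPolicy_succ (k := k) (l := l) (N := N) n ω
      have h0 : levelAfter k N (thresholdPolicy k l N) n ω = 0 := by simp [levelAfter, ← h]
      rw [h0, threshold, min_eq_right le_top] at hx
      rw [battery_succ_of_arrival ih]
      · exact_mod_cast hk
      · rw [hx, hN.lt_iff_timeToArrival_le (h1 n) (max_ne_top (h2 n) ENNReal.coe_ne_top)]
        exact le_max_left _ _
    · simp only [battery]
      refine le_min ?_ (by exact_mod_cast hk)
      have : (0 : ℤ) ≤ k * (arrivals N (thresholdPolicy k l N n ω)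
        (thresholdPolicy k l N (n + 1) ω) ω : ℕ) := by positivity
      linarith

theorem IsPoissonProcess.isAdmissible_thresholdPolicy [IsProbabilityMeasure P]
    (hN : IsPoissonProcess P ℱ N) (hk : 1 ≤ k) : IsAdmissible P ℱ k N (thresholdPolicy k l N) where
  online := hN.isOnlinePolicy_thresholdPolicy
  feasible := by
    filter_upwards [hN.ae_thresholdPolicy_ne_top (k := k) (l := l),
      hN.ae_timeToArrival_thresholdPolicy_ne_top] with ω h1 h2
    exact hN.one_le_battery_thresholdPolicy hk h1 h2
  bounded := by
    refine ⟨2 * (expectedExcess l).toNNReal, fun n => ?_⟩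
    calc ∫⁻ ω, (thresholdPolicy k l N (n + 1) ω - thresholdPolicy k l N n ω) ^ 2 ∂P
        ≤ ∫⁻ ω, 2 * ((l + timeToArrival N (thresholdPolicy k l N n ω) ω) ^ 2 / 2) ∂P := by
          refine lintegral_mono fun ω => ?_
          rw [ENNReal.mul_div_cancel (by norm_num) (by norm_num)]
          gcongr
          exact (thresholdPolicy_sub_le n ω).trans (max_le le_add_self le_self_add)
      _ = _ := by
          rw [lintegral_const_mul' _ _ (by norm_num), hN.lintegral_add_timeToArrival_sq
            (hN.isStoppingTime_thresholdPolicy n).1 ((ae_all_iff.1 hN.ae_thresholdPolicy_ne_top) n)]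
          push_cast
          rfl

end ThresholdPolicy

/-! ### The average age of the threshold policy. -/

section UpperBound

variable {Ω : Type u} [mΩ : MeasurableSpace Ω] {P : Measure Ω} {ℱ : Filtration ℝ≥0 mΩ}
  {N : ℝ≥0 → Ω → ℕ} {k : ℕ} {l : ℝ≥0}

theorem IsPoissonProcess.add_timeToArrival_le (hN : IsPoissonProcess P ℱ N) {a T : ℝ≥0}
    (h : a ≤ T) (ω : Ω) :
    (a : ℝ≥0∞) + timeToArrival N a ω ≤ T + timeToArrival N T ω := by
  obtain ⟨d, rfl⟩ := exists_add_of_le h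
  rw [ENNReal.coe_add, add_assoc]
  gcongr
  by_cases hf : timeToArrival N ((a : ℝ≥0∞) + d) ω = ∞
  · rw [hf]; simp
  · obtain ⟨v, hv⟩ : ∃ v : ℝ≥0, (v : ℝ≥0∞) = timeToArrival N ((a : ℝ≥0∞) + d) ω :=
      ⟨_, ENNReal.coe_toNNReal hf⟩
    have h1 : timeToArrival N ((a + d : ℝ≥0) : ℝ≥0∞) ω ≤ v := by
      rw [ENNReal.coe_add, hv]
    rw [hN.timeToArrival_le_coe_iff, ENNReal.toNNReal_coe] at h1
    rw [← hv, ← ENNReal.coe_add, hN.timeToArrival_le_coe_iff, ENNReal.toNNReal_coe, ← add_assoc]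
    exact (hN.mono ω (show a ≤ a + d by simp)).trans_lt h1

theorem IsPoissonProcess.thresholdPolicy_succ_le (hN : IsPoissonProcess P ℱ N) {T : ℝ≥0} {n : ℕ}
    {ω : Ω} (h : thresholdPolicy k l N n ω ≤ T) :
    thresholdPolicy k l N (n + 1) ω ≤ T + (l + timeToArrival N T ω) := by
  rw [thresholdPolicy_succ]
  have hf : thresholdPolicy k l N n ω ≠ ∞ := ne_top_of_le_ne_top ENNReal.coe_ne_top h
  refine (add_le_add_right (min_le_right _ _) _).trans ?_
  rw [← max_add_add_left]
  refine max_le ?_ ?_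
  · lift thresholdPolicy k l N n ω to ℝ≥0 using hf with a
    refine (hN.add_timeToArrival_le (ENNReal.coe_le_coe.1 h) ω).trans ?_
    gcongr
    exact le_add_self
  · exact add_le_add h le_self_add

/-- The delays begun by time `T` telescope to at most the first update after `T`, which the policy
sends no later than `l` after the next arrival following `T`. -/
theorem IsPoissonProcess.sum_thresholdPolicy_le (hN : IsPoissonProcess P ℱ N) (T : ℝ≥0) (m : ℕ)
    (ω : Ω) :
    ∑ n ∈ Finset.range m, {ω | thresholdPolicy k l N n ω ≤ T}.indicator
        (fun ω => thresholdPolicy k l N (n + 1) ω - thresholdPolicy k l N n ω) ω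
      ≤ min (thresholdPolicy k l N m ω) (T + (l + timeToArrival N T ω)) := by
  induction m with
  | zero => simp
  | succ m ih =>
    rw [Finset.sum_range_succ]
    by_cases h : thresholdPolicy k l N m ω ≤ T
    · rw [Set.indicator_of_mem (by exact h)]
      have h1 := add_le_add_left (ih.trans (min_le_left _ _))
        (thresholdPolicy k l N (m + 1) ω - thresholdPolicy k l N m ω)
      rw [add_tsub_cancel_of_le (thresholdPolicy_step m ω)] at h1
      exact le_min h1 (h1.trans (hN.thresholdPolicy_succ_le h))
    · rw [Set.indicator_of_notMem (by exact h), add_zero]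
      exact ih.trans (min_le_min_right _ (thresholdPolicy_step m ω))

/-- Each delay of the threshold policy balances its cost against the relative values. -/
theorem IsPoissonProcess.lintegral_thresholdPolicy_step [IsProbabilityMeasure P]
    (hN : IsPoissonProcess P ℱ N) (hk : 1 ≤ k) (hl : IsCriticalRate k l) (T : ℝ≥0) (n : ℕ) :
    ∫⁻ ω in {ω | thresholdPolicy k l N n ω ≤ T},
        ((thresholdPolicy k l N (n + 1) ω - thresholdPolicy k l N n ω) ^ 2 / 2
          + stateValue l k N (thresholdPolicy k l N) (n + 1) ω) ∂P
      ≤ ∫⁻ ω in {ω | thresholdPolicy k l N n ω ≤ T},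
        (l * (thresholdPolicy k l N (n + 1) ω - thresholdPolicy k l N n ω)
          + stateValue l k N (thresholdPolicy k l N) n ω) ∂P := by
  have had := hN.isAdmissible_thresholdPolicy (l := l) hk
  have hst := had.online.stopping
  have hmono := fun n (ω : Ω) => thresholdPolicy_step (k := k) (l := l) (N := N) n ω
  refine lintegral_le_of_battery hN hmono hst had.feasible T n fun b hb => ?_
  have hAb : MeasurableSet[(hst n).measurableSpace]
      ({ω | thresholdPolicy k l N n ω ≤ T} ∩
        {ω | battery k N (thresholdPolicy k l N) n ω = b + 1}) :=
    MeasurableSet.inter ((hst n).measurableSet_le' T)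
      (hN.measurable_battery hmono hst n (measurableSet_singleton ((b : ℤ) + 1)))
  have hdelay : ∀ ω, battery k N (thresholdPolicy k l N) n ω = b + 1 →
      thresholdPolicy k l N n ω ≠ ∞ →
      thresholdPolicy k l N (n + 1) ω - thresholdPolicy k l N n ω
        = min (threshold l b) (max (timeToArrival N (thresholdPolicy k l N n ω) ω) l) := by
    intro ω h1 h2
    rw [thresholdPolicy_succ, ENNReal.add_sub_cancel_left h2]
    simp [levelAfter, h1]
  have hfin : ∀ ω, thresholdPolicy k l N n ω ≤ T → thresholdPolicy k l N n ω ≠ ∞ :=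
    fun ω h => ne_top_of_le_ne_top ENNReal.coe_ne_top h
  have key := hN.lintegral_step_le (hst n) (hst (n + 1)) (hmono n) hAb
    (fun ω hω => hfin ω hω.1) ?_ (hl.nonneg b hb) (l := l) ?_
    (Z := stateValue l k N (thresholdPolicy k l N) (n + 1)) ?_ ?_
  · refine key.trans (le_of_eq ?_)
    refine setLIntegral_congr_fun ((hst n).measurableSpace_le _ hAb) fun ω hω => ?_
    simp only [stateValue, show battery k N (thresholdPolicy k l N) n ω = b + 1 from hω.2]
    simp
  · filter_upwards [hN.ae_thresholdPolicy_ne_top (k := k) (l := l)] with ω h _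
    exact h (n + 1)
  · rcases b with _ | b
    · exact Or.inl rfl
    · refine Or.inr ⟨l + (relValue l b).toNNReal, fun ω hω => ?_⟩
      rw [hdelay ω hω.2 (hfin ω hω.1)]
      exact min_le_left _ _
  · filter_upwards [hN.ae_thresholdPolicy_ne_top (k := k) (l := l)] with ω h1 hω hno
    have hx := hdelay ω hω.2 (h1 n)
    have hb1 := battery_succ_of_noArrival hω.2 hno
    have hxfin : thresholdPolicy k l N (n + 1) ω - thresholdPolicy k l N n ω ≠ ∞ :=
      ENNReal.sub_ne_top (h1 _)
    have hlt : thresholdPolicy k l N (n + 1) ω - thresholdPolicy k l N n ω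
        < timeToArrival N (thresholdPolicy k l N n ω) ω := by
      rw [← not_le, ← hN.lt_iff_timeToArrival_le (h1 n) hxfin,
        add_tsub_cancel_of_le (thresholdPolicy_step n ω)]
      have : N (thresholdPolicy k l N (n + 1) ω).toNNReal ω
        = N (thresholdPolicy k l N n ω).toNNReal ω := hno
      omega
    -- An update not preceded by an arrival must have been triggered by the threshold; as the delay
    -- is finite this excludes `b = 0`, and equality holds in the tangency inequality.
    have hx2 : thresholdPolicy k l N (n + 1) ω - thresholdPolicy k l N n ω = threshold l b := by
      rcases min_choice (threshold l b)
        (max (timeToArrival N (thresholdPolicy k l N n ω) ω) l) with h | h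
      · rw [hx, h]
      · rw [hx, h] at hlt
        exact absurd (le_max_left _ _) (not_le.2 hlt)
    rcases b with _ | b
    · exact absurd hx2 hxfin
    · have hh := hl.nonneg b (by omega)
      have e1 : (thresholdPolicy k l N (n + 1) ω - thresholdPolicy k l N n ω).toReal
          = l + relValue l b := by
        rw [hx2, threshold, ENNReal.coe_toReal, NNReal.coe_add, Real.coe_toNNReal _ hh]
      have e2 : (((b + 1 : ℕ) : ℤ) - 1).toNat = b := by omega
      rw [e1, stateValue, hb1, e2, ← ENNReal.ofReal_mul (stopCoeff_nonneg _ _),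
        ← ENNReal.ofReal_add (by positivity) hh,
        ← ENNReal.ofReal_add (by positivity) (mul_nonneg (stopCoeff_nonneg _ _) (by positivity))]
      refine ENNReal.ofReal_le_ofReal (le_of_eq ?_)
      rw [add_sub_cancel_left, ← expectedExcess_stop hh]
      simp only [stopCoeff]
      rw [Real.exp_add]
      have : Real.exp (-(l : ℝ)) * Real.exp l = 1 := by rw [← Real.exp_add]; simp
      linear_combination (Real.exp (-relValue l b) * Real.exp (relValue l b)) * this
  · filter_upwards [hN.ae_thresholdPolicy_ne_top (k := k) (l := l),
      hN.ae_timeToArrival_thresholdPolicy_ne_top (k := k) (l := l), had.feasible]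
      with ω h1 h2 h3 hω hno
    have hx := hdelay ω hω.2 (h1 n)
    have hlt : N (thresholdPolicy k l N n ω).toNNReal ω
        < N (thresholdPolicy k l N (n + 1) ω).toNNReal ω :=
      lt_of_le_of_ne (hN.mono ω (ENNReal.toNNReal_mono (h1 (n + 1)) (thresholdPolicy_step n ω)))
        (Ne.symm hno)
    have hb1 := battery_succ_of_arrival (h3 n) hlt
    have e2 : ((k : ℤ) - 1).toNat = k - 1 := by omega
    -- After an arrival the battery is full, and the next relative value is zero by the choice of
    -- `l`. The delay lies between `l` and `max τ l`, which bounds its squared distance to `l`.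
    rw [stateValue, hb1, e2, hl.last, ENNReal.ofReal_zero, add_zero, hx]
    refine ENNReal.ofReal_le_ofReal ?_
    have hmaxfin : max (timeToArrival N (thresholdPolicy k l N n ω) ω) (l : ℝ≥0∞) ≠ ∞ :=
      max_ne_top (h2 n) ENNReal.coe_ne_top
    have b1 : (l : ℝ) ≤ (min (threshold l b)
        (max (timeToArrival N (thresholdPolicy k l N n ω) ω) l)).toReal := by
      have := ENNReal.toReal_mono (ne_top_of_le_ne_top hmaxfin (min_le_right _ _))
        (le_min (le_threshold l b) (le_max_right
          (timeToArrival N (thresholdPolicy k l N n ω) ω) (l : ℝ≥0∞)))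
      simpa using this
    have b2 : (min (threshold l b)
        (max (timeToArrival N (thresholdPolicy k l N n ω) ω) l)).toReal
        ≤ max (timeToArrival N (thresholdPolicy k l N n ω) ω).toReal l := by
      have := ENNReal.toReal_mono hmaxfin (min_le_right (threshold l b)
        (max (timeToArrival N (thresholdPolicy k l N n ω) ω) l))
      rwa [ENNReal.toReal_max (h2 n) ENNReal.coe_ne_top, ENNReal.coe_toReal] at this
    have b3 : max (timeToArrival N (thresholdPolicy k l N n ω) ω).toReal (l : ℝ) - l
        = max ((timeToArrival N (thresholdPolicy k l N n ω) ω).toReal - l) 0 := by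
      rw [← max_sub_sub_right, sub_self]
    rw [← b3]
    gcongr

theorem IsPoissonProcess.sum_lintegral_thresholdPolicy_le [IsProbabilityMeasure P]
    (hN : IsPoissonProcess P ℱ N) (hk : 1 ≤ k) (hl : IsCriticalRate k l) (T : ℝ≥0) (m : ℕ) :
    ∑ n ∈ Finset.range m, ∫⁻ ω in {ω | thresholdPolicy k l N n ω ≤ T},
        (thresholdPolicy k l N (n + 1) ω - thresholdPolicy k l N n ω) ^ 2 / 2 ∂P
      ≤ l * (T + (l + ∫⁻ ω, timeToArrival N T ω ∂P)) := by
  set s := thresholdPolicy k l N with hs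
  have had := hN.isAdmissible_thresholdPolicy (l := l) hk
  have hst := had.online.stopping
  have hmono := fun n (ω : Ω) => thresholdPolicy_step (k := k) (l := l) (N := N) n ω
  have hsm : ∀ n, Measurable (s n) := fun n => measurable_of_stoppingTime (hst n)
  have hVm := measurable_stateValue (l := l) (k := k) hN hmono hst
  have hAm : ∀ n, MeasurableSet {ω | s n ω ≤ T} := fun n => measurableSet_le (hsm n) measurable_const
  obtain ⟨C, hC⟩ := exists_stateValue_le l k N s
  set v : ℕ → ℝ≥0∞ := fun n => ∫⁻ ω in {ω | s n ω ≤ T}, stateValue l k N s n ω ∂P with hv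
  set w : ℕ → ℝ≥0∞ := fun n => ∫⁻ ω in {ω | s n ω ≤ T}, stateValue l k N s (n + 1) ω ∂P with hw
  have hvw : ∀ n, v (n + 1) ≤ w n := fun n =>
    lintegral_mono_set fun ω hω => le_trans (hmono n ω) hω
  have hv0 : v 0 = 0 := by
    have : ∀ ω, stateValue l k N s 0 ω = 0 := by
      intro ω
      have e2 : ((k : ℤ) - 1).toNat = k - 1 := by omega
      simp only [stateValue, battery, e2, hl.last, ENNReal.ofReal_zero]
    simp [hv, this]
  have hwfin : ∀ n, w n ≠ ∞ := by
    intro n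
    refine ne_top_of_le_ne_top ENNReal.coe_ne_top (b := C) ?_
    calc w n ≤ ∫⁻ _ in {ω | s n ω ≤ T}, C ∂P := lintegral_mono fun ω => hC _ _
      _ = C * P {ω | s n ω ≤ T} := setLIntegral_const _ _
      _ ≤ C := mul_le_of_le_one_right' prob_le_one
  -- The relative values received dominate those paid because the initial one vanishes: the first
  -- update leaves `k - 1` units.
  have hvsum : ∑ n ∈ Finset.range m, v n ≤ ∑ n ∈ Finset.range m, w n := by
    cases m with
    | zero => simp
    | succ m =>
      rw [Finset.sum_range_succ', hv0, add_zero, Finset.sum_range_succ]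
      exact (Finset.sum_le_sum fun n _ => hvw n).trans le_self_add
  have hstep : ∀ n, ∫⁻ ω in {ω | s n ω ≤ T}, (s (n + 1) ω - s n ω) ^ 2 / 2 ∂P + w n
      ≤ ∫⁻ ω in {ω | s n ω ≤ T}, l * (s (n + 1) ω - s n ω) ∂P + v n := by
    intro n
    have h := hN.lintegral_thresholdPolicy_step hk hl T n
    rwa [lintegral_add_right _ (hVm (n + 1)), lintegral_add_right _ (hVm n)] at h
  have h1 := Finset.sum_le_sum fun n (_ : n ∈ Finset.range m) => hstep n
  simp only [Finset.sum_add_distrib] at h1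
  have h2 : ∑ n ∈ Finset.range m, ∫⁻ ω in {ω | s n ω ≤ T}, (s (n + 1) ω - s n ω) ^ 2 / 2 ∂P
      ≤ ∑ n ∈ Finset.range m, ∫⁻ ω in {ω | s n ω ≤ T}, l * (s (n + 1) ω - s n ω) ∂P :=
    (ENNReal.add_le_add_iff_right (ENNReal.sum_ne_top.2 fun n _ => hwfin n)).1
      (h1.trans (by gcongr))
  refine h2.trans ?_
  have hdm : ∀ n, Measurable fun ω => s (n + 1) ω - s n ω := fun n => (hsm (n + 1)).sub (hsm n)
  have h3 : ∀ n, ∫⁻ ω in {ω | s n ω ≤ T}, l * (s (n + 1) ω - s n ω) ∂P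
      = l * ∫⁻ ω, {ω | s n ω ≤ T}.indicator (fun ω => s (n + 1) ω - s n ω) ω ∂P := by
    intro n
    rw [lintegral_const_mul _ (hdm n), lintegral_indicator (hAm n)]
  simp only [h3]
  rw [← Finset.mul_sum, ← lintegral_finsetSum _ fun n _ => (hdm n).indicator (hAm n)]
  gcongr
  calc _ ≤ ∫⁻ ω, ((T + l : ℝ≥0) + timeToArrival N T ω) ∂P := by
        refine lintegral_mono fun ω => ?_
        refine (hN.sum_thresholdPolicy_le T m ω).trans ((min_le_right _ _).trans ?_)
        push_cast
        rw [add_assoc]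
    _ = _ := by
        rw [lintegral_add_left measurable_const]
        simp [add_assoc]

/-- Only a bound uniform in `T` matters, so `x ≤ (1 + x)² / 2` suffices. -/
theorem IsPoissonProcess.lintegral_timeToArrival_le [IsProbabilityMeasure P]
    (hN : IsPoissonProcess P ℱ N) (T : ℝ≥0) :
    ∫⁻ ω, timeToArrival N T ω ∂P ≤ ENNReal.ofReal (expectedExcess (1 : ℝ≥0)) := by
  rw [← hN.lintegral_add_timeToArrival_sq (isStoppingTime_const ℱ T)
    (ae_of_all _ fun ω => ENNReal.coe_ne_top) 1]
  refine lintegral_mono fun ω => ?_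
  change timeToArrival N (T : ℝ≥0∞) ω ≤ (((1 : ℝ≥0) : ℝ≥0∞) + timeToArrival N (T : ℝ≥0∞) ω) ^ 2 / 2
  generalize timeToArrival N (T : ℝ≥0∞) ω = x
  rw [ENNReal.coe_one, ENNReal.le_div_iff_mul_le (by simp) (by simp)]
  have : (1 + x) ^ 2 = x * 2 + (1 + x ^ 2) := by ring
  rw [this]
  exact le_self_add

/-- The threshold policy of a critical rate has a long term average age of at most that rate. -/
theorem IsPoissonProcess.averageAge_thresholdPolicy_le [IsProbabilityMeasure P]
    (hN : IsPoissonProcess P ℱ N) (hk : 1 ≤ k) (hl : IsCriticalRate k l) :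
    averageAge P (thresholdPolicy k l N) ≤ l := by
  set s := thresholdPolicy k l N with hs
  have had := hN.isAdmissible_thresholdPolicy (l := l) hk
  have hst := had.online.stopping
  have hsm : ∀ n, Measurable (s n) := fun n => measurable_of_stoppingTime (hst n)
  have hAm : ∀ (T : ℝ≥0) n, MeasurableSet {ω | s n ω ≤ T} :=
    fun T n => measurableSet_le (hsm n) measurable_const
  have hdm : ∀ n, Measurable fun ω => (s (n + 1) ω - s n ω) ^ 2 / 2 :=
    fun n => (((hsm (n + 1)).sub (hsm n)).pow_const 2).div_const 2
  set C : ℝ≥0 := l * (l + (expectedExcess (1 : ℝ≥0)).toNNReal) with hC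
  have hbound : ∀ T : ℝ≥0, ∫⁻ ω, ageArea s T ω ∂P ≤ l * T + C := by
    intro T
    have h1 : ∫⁻ ω, ageArea s T ω ∂P
        ≤ ∫⁻ ω, ∑' n, {ω | s n ω ≤ T}.indicator (fun ω => (s (n + 1) ω - s n ω) ^ 2 / 2) ω ∂P := by
      refine lintegral_mono_ae ?_
      filter_upwards [had.feasible] with ω hω
      have hT := hN.exists_lt_of_forall_one_le_battery had.online hω T
      have hiff := le_numUpdates_iff (had.online.zero ω) (had.online.mono ω) hT
      rw [← hs] at hiff
      rw [ageArea]
      generalize numUpdates s T ω = M at hiff ⊢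
      -- The extra index `M` covers the delay in progress at `T`, which is counted in full.
      refine le_trans ?_ (ENNReal.sum_le_tsum (Finset.range (M + 1)))
      rw [Finset.sum_range_succ,
        Set.indicator_of_mem (show ω ∈ {ω | s M ω ≤ T} from (hiff _).2 le_rfl)]
      gcongr ?_ + ?_ ^ 2 / 2
      · simp only [div_eq_mul_inv, Finset.sum_mul]
        refine Finset.sum_le_sum fun n hn => ?_
        rw [Set.indicator_of_mem (show ω ∈ {ω | s n ω ≤ T} from
          (hiff n).2 (Finset.mem_range.1 hn).le)]
      · gcongr
        refine (not_le.1 fun h => ?_).le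
        have := (hiff _).1 h
        omega
    refine h1.trans ?_
    rw [lintegral_tsum fun n => ((hdm n).indicator (hAm T n)).aemeasurable]
    refine ENNReal.tsum_le_of_sum_range_le fun m => ?_
    simp only [lintegral_indicator (hAm T _)]
    refine (hN.sum_lintegral_thresholdPolicy_le hk hl T m).trans ?_
    calc _ ≤ l * (T + (l + ENNReal.ofReal (expectedExcess (1 : ℝ≥0)))) := by
          gcongr
          exact hN.lintegral_timeToArrival_le T
      _ = _ := by rw [hC]; push_cast; rw [mul_add]; rfl
  have hlim : Tendsto (fun T : ℝ≥0 => (l : ℝ≥0∞) + C / T) atTop (nhds (l + 0)) := by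
    refine tendsto_const_nhds.add ?_
    have h1 : Tendsto (fun T : ℝ≥0 => (T : ℝ≥0∞)) atTop (nhds ∞) :=
      ENNReal.tendsto_coe_nhds_top.2 tendsto_id
    have := ENNReal.Tendsto.const_div h1 (a := (C : ℝ≥0∞)) (Or.inr ENNReal.coe_ne_top)
    simpa using this
  rw [add_zero] at hlim
  rw [averageAge, ← hlim.limsup_eq]
  refine limsup_le_limsup ?_
  filter_upwards [eventually_gt_atTop 0] with T hT
  have hT0 : (T : ℝ≥0∞) ≠ 0 := by simpa using hT.ne'
  calc _ ≤ ((l : ℝ≥0∞) * T + C) / T := ENNReal.div_le_div_right (hbound T) _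
    _ = _ := by rw [ENNReal.add_div, ENNReal.mul_div_cancel_right hT0 ENNReal.coe_ne_top]

end UpperBound

/-! ### Epoch offsets and lengths. -/

section Epochs

/-- The time from the start of an epoch to its `q`-th update if no energy arrives before. -/
noncomputable def offset (k : ℕ) (l : ℝ≥0) (q : ℕ) : ℝ≥0 :=
  ∑ i ∈ Finset.range q, (l + (relValue l (k - 2 - i)).toNNReal)

theorem offset_mono (k : ℕ) (l : ℝ≥0) : Monotone (offset k l) :=
  fun _ _ h => Finset.sum_le_sum_of_subset (Finset.range_mono h)

theorem offset_zero (k : ℕ) (l : ℝ≥0) : offset k l 0 = 0 := by simp [offset]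

theorem offset_succ {k q : ℕ} (l : ℝ≥0) (h : q + 1 ≤ k - 1) :
    (offset k l (q + 1) : ℝ≥0∞) = offset k l q + threshold l (k - 1 - q) := by
  have e : k - 1 - q = (k - 2 - q) + 1 := by omega
  rw [offset, Finset.sum_range_succ, ← offset, e, threshold, ENNReal.coe_add]

/-- The length of an epoch as a function of the time to the first arrival. -/
noncomputable def epochLength (k : ℕ) (l t : ℝ≥0) : ℝ≥0 :=
  max t (l + (Finset.range k).sup fun q => if offset k l q ≤ t then offset k l q else 0)

theorem measurable_epochLength (k : ℕ) (l : ℝ≥0) : Measurable (epochLength k l) := by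
  unfold epochLength
  refine measurable_id.max (measurable_const.add ?_)
  induction Finset.range k using Finset.induction_on with
  | empty => simp
  | insert q S _ ih =>
    simp only [Finset.sup_insert]
    exact (Measurable.ite measurableSet_Ici measurable_const measurable_const).sup ih

theorem epochLength_eq {k : ℕ} {l t : ℝ≥0} {Q : ℕ} (hQ : Q < k) (hQt : offset k l Q ≤ t)
    (hmax : ∀ q, q < k → offset k l q ≤ t → q ≤ Q) :
    epochLength k l t = max t (l + offset k l Q) := by
  unfold epochLength
  congr 2
  refine le_antisymm (Finset.sup_le fun q hq => ?_) ?_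
  · split_ifs with h
    · exact offset_mono k l (hmax q (Finset.mem_range.1 hq) h)
    · exact zero_le
  · refine le_trans ?_ (Finset.le_sup (Finset.mem_range.2 hQ))
    rw [if_pos hQt]

variable {Ω : Type u} {k : ℕ} {l : ℝ≥0} {N : ℝ≥0 → Ω → ℕ} {ω : Ω}

/-- The sample paths without the null events: all times are finite, and no arrival coincides with
the deadline of an epoch. -/
structure IsRegularPath (k : ℕ) (l : ℝ≥0) (N : ℝ≥0 → Ω → ℕ) (ω : Ω) : Prop where
  finite : ∀ n, thresholdPolicy k l N n ω ≠ ∞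
  arrival : ∀ n, timeToArrival N (thresholdPolicy k l N n ω) ω ≠ ∞
  ne_offset : ∀ n q, timeToArrival N (thresholdPolicy k l N n ω) ω ≠ offset k l q

/-- The number of updates in an epoch before its final one. -/
noncomputable def innerUpdates (k : ℕ) (l : ℝ≥0) (t : ℝ≥0∞) : ℕ :=
  open Classical in Nat.findGreatest (fun q => (offset k l q : ℝ≥0∞) < t) (k - 1)

theorem innerUpdates_le (k : ℕ) (l : ℝ≥0) (t : ℝ≥0∞) : innerUpdates k l t ≤ k - 1 :=
  Nat.findGreatest_le _

theorem offset_lt_iff {t : ℝ≥0∞} (ht : 0 < t) {q : ℕ} (hq : q ≤ k - 1) :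
    (offset k l q : ℝ≥0∞) < t ↔ q ≤ innerUpdates k l t := by
  classical
  constructor
  · intro h
    unfold innerUpdates
    exact Nat.le_findGreatest hq h
  · intro h
    have h0 : (offset k l 0 : ℝ≥0∞) < t := by simpa [offset_zero] using ht
    have : (offset k l (innerUpdates k l t) : ℝ≥0∞) < t := by
      unfold innerUpdates
      exact Nat.findGreatest_spec (P := fun q => (offset k l q : ℝ≥0∞) < t) (Nat.zero_le _) h0
    exact lt_of_le_of_lt (ENNReal.coe_le_coe.2 (offset_mono k l h)) this

theorem nth_succ_eq {p : ℕ → Prop} (hp : {n | p n}.Infinite) {i m' : ℕ} (hm' : p m')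
    (hlt : Nat.nth p i < m') (h : ∀ n, Nat.nth p i < n → n < m' → ¬ p n) :
    Nat.nth p (i + 1) = m' := by
  refine le_antisymm ?_ ?_
  · by_contra! h1
    obtain ⟨j, hj⟩ : m' ∈ Set.range (Nat.nth p) := by
      rw [Nat.range_nth_of_infinite hp]
      exact hm'
    rw [← hj] at h1 hlt
    have h2 := (Nat.nth_strictMono hp).lt_iff_lt.1 h1
    have h3 := (Nat.nth_strictMono hp).lt_iff_lt.1 hlt
    omega
  · by_contra! h1
    exact h _ (Nat.nth_strictMono hp i.lt_succ_self) h1 (Nat.nth_mem_of_infinite hp _)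

theorem epochStart_zero (ω : Ω) : epochStart k N (thresholdPolicy k l N) 0 ω = 0 := by
  have : epochIndex k N (thresholdPolicy k l N) 0 ω = 0 := Nat.nth_zero_of_zero rfl
  rw [epochStart, this, thresholdPolicy_zero]

theorem expMeasure_singleton (x : ℝ) : expMeasure 1 {x} = 0 := by
  have h2 : expMeasure 1 = volume.withDensity (exponentialPDF 1) := rfl
  rw [h2]
  exact withDensity_absolutelyContinuous _ _ Real.volume_singleton

end Epochs

/-! ### The course of one epoch of the threshold policy. -/

section EpochPaths

variable {Ω : Type u} [mΩ : MeasurableSpace Ω] {P : Measure Ω} {ℱ : Filtration ℝ≥0 mΩ}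
  {N : ℝ≥0 → Ω → ℕ} {k : ℕ} {l : ℝ≥0} {ω : Ω}

/-- Until the first arrival the battery drops by one per update, so successive thresholds are
deterministic and add up to `offset`. -/
theorem IsPoissonProcess.inner_update (hN : IsPoissonProcess P ℱ N) (hω : IsRegularPath k l N ω)
    {m : ℕ} (hm : battery k N (thresholdPolicy k l N) m ω = k) {q : ℕ} (hq : q ≤ k - 1)
    (hk : 1 ≤ k)
    (hlt : (offset k l q : ℝ≥0∞) < timeToArrival N (thresholdPolicy k l N m ω) ω) :
    thresholdPolicy k l N (m + q) ω = thresholdPolicy k l N m ω + offset k l q ∧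
      battery k N (thresholdPolicy k l N) (m + q) ω = k - q ∧
      timeToArrival N (thresholdPolicy k l N m ω) ω
        = offset k l q + timeToArrival N (thresholdPolicy k l N (m + q) ω) ω := by
  set s := thresholdPolicy k l N with hs
  have hadd : ∀ q, (offset k l q : ℝ≥0∞) < timeToArrival N (s m ω) ω →
      s (m + q) ω = s m ω + offset k l q →
      timeToArrival N (s m ω) ω = offset k l q + timeToArrival N (s (m + q) ω) ω := by
    intro q h1 h2
    have h3 := (hN.coe_lt_timeToArrival_iff _ _ _).1 h1
    have h4 := hN.timeToArrival_add _ _ _ h3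
    rw [ENNReal.coe_add, ENNReal.coe_toNNReal (hω.finite m)] at h4
    rw [h2, h4]
  suffices h : s (m + q) ω = s m ω + offset k l q ∧ battery k N s (m + q) ω = k - q from
    ⟨h.1, h.2, hadd q hlt h.1⟩
  induction q with
  | zero => simp [offset_zero, hm]
  | succ q ih =>
    have hlt' : (offset k l q : ℝ≥0∞) < timeToArrival N (s m ω) ω :=
      lt_of_le_of_lt (ENNReal.coe_le_coe.2 (offset_mono k l q.le_succ)) hlt
    obtain ⟨h1, h2⟩ := ih (by omega) hlt'
    have h3 := hadd q hlt' h1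
    have hlev : levelAfter k N s (m + q) ω = k - 1 - q := by
      rw [levelAfter, h2]
      omega
    have hth : threshold l (k - 1 - q) < timeToArrival N (s (m + q) ω) ω := by
      rw [offset_succ l hq, h3] at hlt
      exact (ENNReal.add_lt_add_iff_left ENNReal.coe_ne_top).1 hlt
    have hstep : s (m + q + 1) ω = s (m + q) ω + threshold l (k - 1 - q) := by
      rw [hs, thresholdPolicy_succ, ← hs, hlev, min_eq_left (hth.le.trans (le_max_left _ _))]
    refine ⟨?_, ?_⟩
    · rw [← add_assoc, hstep, h1, offset_succ l hq, add_assoc]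
    · have hno : ω ∈ noArrival N (s (m + q)) (s (m + q + 1)) := by
        have hle := hN.mono ω (ENNReal.toNNReal_mono (hω.finite (m + q + 1))
          (thresholdPolicy_step (k := k) (l := l) (N := N) (m + q) ω))
        have := (hN.lt_iff_timeToArrival_le (hω.finite (m + q))
          (x := threshold l (k - 1 - q)) (ne_top_of_lt hth)).not.2 (not_le.2 hth)
        rw [← hs, ← hstep] at this
        exact le_antisymm (not_lt.1 this) hle
      have h4 := battery_succ_of_noArrival (b := k - 1 - q) (by rw [h2]; omega) hno
      rw [← add_assoc, h4]
      omega

/-- The next offset is not reached before the arrival, or the battery is empty. Either way the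
policy updates at the arrival, or at age `l` if that is later, and finds the battery full. -/
theorem IsPoissonProcess.final_update (hN : IsPoissonProcess P ℱ N) (hω : IsRegularPath k l N ω)
    (hk : 1 ≤ k) {m : ℕ} (hm : battery k N (thresholdPolicy k l N) m ω = k) :
    let τ := timeToArrival N (thresholdPolicy k l N m ω) ω
    thresholdPolicy k l N (m + innerUpdates k l τ + 1) ω
        = thresholdPolicy k l N m ω + epochLength k l τ.toNNReal ∧
      battery k N (thresholdPolicy k l N) (m + innerUpdates k l τ + 1) ω = k := by
  intro τ
  set s := thresholdPolicy k l N with hs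
  set Q := innerUpdates k l τ with hQ
  have hτ0 : 0 < τ := hN.timeToArrival_pos _ _
  have hQk : Q ≤ k - 1 := innerUpdates_le k l τ
  have hlt : (offset k l Q : ℝ≥0∞) < τ := (offset_lt_iff hτ0 hQk).2 le_rfl
  obtain ⟨h1, h2, h3⟩ := hN.inner_update hω hm hQk hk hlt
  rw [← hs] at h1 h2 h3
  have h3' : τ = offset k l Q + timeToArrival N (s (m + Q) ω) ω := h3
  have hlev : levelAfter k N s (m + Q) ω = k - 1 - Q := by
    rw [levelAfter, h2]
    omega
  have hth : max (timeToArrival N (s (m + Q) ω) ω) l ≤ threshold l (k - 1 - Q) := by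
    refine max_le ?_ (le_threshold l _)
    rcases hQk.eq_or_lt with h | h
    · rw [h, Nat.sub_self]
      exact le_top
    · have h4 : ¬ ((offset k l (Q + 1) : ℝ≥0∞) < τ) := by
        rw [offset_lt_iff hτ0 (by omega)]
        omega
      rw [not_lt, offset_succ l (by omega)] at h4
      exact (ENNReal.add_le_add_iff_left ENNReal.coe_ne_top).1 (h3' ▸ h4)
  have hstep : s (m + Q + 1) ω = s (m + Q) ω + max (timeToArrival N (s (m + Q) ω) ω) l := by
    rw [hs, thresholdPolicy_succ, ← hs, hlev, min_eq_right hth]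
  have hτfin : τ ≠ ∞ := hω.arrival m
  refine ⟨?_, ?_⟩
  · rw [epochLength_eq (Q := Q) (by omega)]
    · generalize timeToArrival N (s (m + Q) ω) ω = X at hstep h3'
      rw [hstep, h1, add_assoc, ← max_add_add_left, ← h3', ENNReal.coe_max, ENNReal.coe_toNNReal hτfin,
        ENNReal.coe_add, add_comm (l : ℝ≥0∞)]
    · rw [← ENNReal.coe_le_coe, ENNReal.coe_toNNReal hτfin]
      exact hlt.le
    · intro q hq hqτ
      rw [← ENNReal.coe_le_coe, ENNReal.coe_toNNReal hτfin] at hqτ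
      -- Passing from a weak to a strict inequality uses that no arrival falls exactly on an offset.
      exact (offset_lt_iff hτ0 (by omega)).1 (lt_of_le_of_ne hqτ (hω.ne_offset m q).symm)
  · refine battery_succ_of_arrival ?_ ?_
    · rw [h2]
      omega
    · rw [hstep, hN.lt_iff_timeToArrival_le (hω.finite (m + Q))
        (max_ne_top (hω.arrival (m + Q)) ENNReal.coe_ne_top)]
      exact le_max_left _ _

theorem IsPoissonProcess.battery_ne_of_lt (hN : IsPoissonProcess P ℱ N)
    (hω : IsRegularPath k l N ω) (hk : 1 ≤ k) {m : ℕ}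
    (hm : battery k N (thresholdPolicy k l N) m ω = k) {n : ℕ} (hmn : m < n)
    (hn : n < m + innerUpdates k l (timeToArrival N (thresholdPolicy k l N m ω) ω) + 1) :
    battery k N (thresholdPolicy k l N) n ω ≠ k := by
  obtain ⟨q, rfl⟩ := Nat.exists_eq_add_of_lt hmn
  have hQ := innerUpdates_le k l (timeToArrival N (thresholdPolicy k l N m ω) ω)
  have h := hN.inner_update hω hm (q := q + 1) (by omega) hk
    ((offset_lt_iff (hN.timeToArrival_pos _ _) (by omega)).2 (by omega))
  rw [← add_assoc] at h
  rw [h.2.1]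
  push_cast
  omega

theorem IsPoissonProcess.infinite_full (hN : IsPoissonProcess P ℱ N) (hω : IsRegularPath k l N ω)
    (hk : 1 ≤ k) : {n : ℕ | battery k N (thresholdPolicy k l N) n ω = k}.Infinite := by
  have hnext : ∀ m, battery k N (thresholdPolicy k l N) m ω = k →
      ∃ m', m < m' ∧ battery k N (thresholdPolicy k l N) m' ω = k := fun m hm =>
    ⟨_, by omega, (hN.final_update hω hk hm).2⟩
  refine Set.infinite_of_forall_exists_gt fun a => ?_
  induction a with
  | zero =>
    obtain ⟨m', h1, h2⟩ := hnext 0 rfl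
    exact ⟨m', h2, h1⟩
  | succ a ih =>
    obtain ⟨b, hb, hab⟩ := ih
    rcases (Nat.succ_le_of_lt hab).eq_or_lt with h | h
    · obtain ⟨m', h1, h2⟩ := hnext b hb
      exact ⟨m', h2, by omega⟩
    · exact ⟨b, hb, h⟩

theorem IsPoissonProcess.epochIndex_succ (hN : IsPoissonProcess P ℱ N)
    (hω : IsRegularPath k l N ω) (hk : 1 ≤ k) (i : ℕ) :
    epochIndex k N (thresholdPolicy k l N) (i + 1) ω
      = epochIndex k N (thresholdPolicy k l N) i ω
        + innerUpdates k l (timeToArrival N (epochStart k N (thresholdPolicy k l N) i ω) ω) + 1 := by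
  have hinf := hN.infinite_full hω hk
  have hm : battery k N (thresholdPolicy k l N) (epochIndex k N (thresholdPolicy k l N) i ω) ω = k :=
    Nat.nth_mem_of_infinite hinf i
  exact nth_succ_eq hinf (hN.final_update hω hk hm).2 (by unfold epochIndex; omega)
    fun n h1 h2 => hN.battery_ne_of_lt hω hk hm h1 h2

theorem IsPoissonProcess.epochStart_succ (hN : IsPoissonProcess P ℱ N)
    (hω : IsRegularPath k l N ω) (hk : 1 ≤ k) (i : ℕ) :
    epochStart k N (thresholdPolicy k l N) (i + 1) ω
      = epochStart k N (thresholdPolicy k l N) i ω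
        + epochLength k l
          (timeToArrival N (epochStart k N (thresholdPolicy k l N) i ω) ω).toNNReal := by
  have hinf := hN.infinite_full hω hk
  have hm : battery k N (thresholdPolicy k l N) (epochIndex k N (thresholdPolicy k l N) i ω) ω = k :=
    Nat.nth_mem_of_infinite hinf i
  rw [epochStart, hN.epochIndex_succ hω hk i]
  exact (hN.final_update hω hk hm).1

/-- Ties are null events because the exponential law has no atoms and only countably many pairs of
an update and an offset occur. -/
theorem IsPoissonProcess.ae_isRegularPath [IsProbabilityMeasure P] (hN : IsPoissonProcess P ℱ N) :
    ∀ᵐ ω ∂P, IsRegularPath k l N ω := by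
  have h : ∀ᵐ ω ∂P, ∀ n q, timeToArrival N (thresholdPolicy k l N n ω) ω ≠ offset k l q := by
    rw [ae_all_iff]
    intro n
    rw [ae_all_iff]
    intro q
    have h1 := hN.lintegral_timeToArrival_of_ae (hN.isStoppingTime_thresholdPolicy n).1
      ((ae_all_iff.1 (hN.ae_thresholdPolicy_ne_top (k := k) (l := l))) n)
      (f := ({(offset k l q : ℝ)} : Set ℝ).indicator 1)
      (measurable_one.indicator (measurableSet_singleton _))
    have hm := (hN.measurable_timeToArrival (measurable_of_stoppingTime
      (hN.isStoppingTime_thresholdPolicy (k := k) (l := l) n).1)).ennreal_toReal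
    rw [lintegral_indicator_one (measurableSet_singleton _), expMeasure_singleton,
      lintegral_eq_zero_iff (by
        exact (measurable_one.indicator (measurableSet_singleton (offset k l q : ℝ))).comp hm)] at h1
    filter_upwards [h1] with ω hω heq
    simp [heq] at hω
  filter_upwards [hN.ae_thresholdPolicy_ne_top (k := k) (l := l),
    hN.ae_timeToArrival_thresholdPolicy_ne_top (k := k) (l := l), h] with ω h1 h2 h3
  exact ⟨h1, h2, h3⟩

theorem IsPoissonProcess.hasConstantOffsets_thresholdPolicy [IsProbabilityMeasure P]
    (hN : IsPoissonProcess P ℱ N) (hk : 1 ≤ k) :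
    HasConstantOffsets P k N (thresholdPolicy k l N) (fun j => offset k l (k - j))
      (epochLength k l) := by
  filter_upwards [hN.ae_isRegularPath (k := k) (l := l)] with ω hω
  refine ⟨hN.infinite_full hω hk, fun i => ?_⟩
  have hm : battery k N (thresholdPolicy k l N) (epochIndex k N (thresholdPolicy k l N) i ω) ω = k :=
    Nat.nth_mem_of_infinite (hN.infinite_full hω hk) i
  refine ⟨hω.arrival _, hN.epochStart_succ hω hk i, fun j hj1 hj2 => ?_⟩
  have hτ0 := hN.timeToArrival_pos (epochStart k N (thresholdPolicy k l N) i ω) ω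
  have hiff : epochIndex k N (thresholdPolicy k l N) i ω + (k - j)
        < epochIndex k N (thresholdPolicy k l N) (i + 1) ω
      ↔ (offset k l (k - j) : ℝ≥0∞)
        < timeToArrival N (epochStart k N (thresholdPolicy k l N) i ω) ω := by
    rw [hN.epochIndex_succ hω hk i, offset_lt_iff hτ0 (by omega)]
    omega
  refine ⟨?_, fun h => ?_⟩
  · rw [hiff]
    exact ⟨le_of_lt, fun h => lt_of_le_of_ne h (hω.ne_offset _ _).symm⟩
  · exact (hN.inner_update hω hm (by omega) hk (hiff.1 h)).1

end EpochPaths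

/-! ### An explicit model of the renewal epochs. -/

section RenewalTimes

variable {Ω : Type u} {N : ℝ≥0 → Ω → ℕ} {g : ℝ≥0 → ℝ≥0}

/-- The renewal epochs with cycle lengths `g`, rebuilt as explicit stopping times. The cycle after
`r` is the waiting time for the first arrival after `r` followed by the rest of the cycle. -/
noncomputable def renewalTime (g : ℝ≥0 → ℝ≥0) (N : ℝ≥0 → Ω → ℕ) : ℕ → Ω → ℝ≥0∞
  | 0, _ => 0
  | i + 1, ω =>
    renewalTime g N i ω + timeToArrival N (renewalTime g N i ω) ω
      + (g (renewalTime g N i ω + timeToArrival N (renewalTime g N i ω) ω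
          - renewalTime g N i ω).toNNReal
        - (renewalTime g N i ω + timeToArrival N (renewalTime g N i ω) ω
          - renewalTime g N i ω).toNNReal : ℝ≥0)

/-- The waiting time for the first arrival in the `i`-th cycle. -/
noncomputable def renewalWait (g : ℝ≥0 → ℝ≥0) (N : ℝ≥0 → Ω → ℕ) (i : ℕ) (ω : Ω) : ℝ≥0∞ :=
  renewalTime g N i ω + timeToArrival N (renewalTime g N i ω) ω - renewalTime g N i ω

theorem renewalTime_succ (i : ℕ) (ω : Ω) :
    renewalTime g N (i + 1) ω
      = renewalTime g N i ω + timeToArrival N (renewalTime g N i ω) ω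
        + (g (renewalWait g N i ω).toNNReal - (renewalWait g N i ω).toNNReal : ℝ≥0) := rfl

theorem renewalTime_step (i : ℕ) (ω : Ω) : renewalTime g N i ω ≤ renewalTime g N (i + 1) ω := by
  rw [renewalTime_succ, add_assoc]
  exact le_self_add

end RenewalTimes

/-! ### Independence and common law of the epoch lengths. -/

section Renewal

variable {Ω : Type u} [mΩ : MeasurableSpace Ω] {P : Measure Ω} {ℱ : Filtration ℝ≥0 mΩ}
  {N : ℝ≥0 → Ω → ℕ} {k : ℕ} {l : ℝ≥0}
  {g : ℝ≥0 → ℝ≥0}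

theorem IsPoissonProcess.measurable_renewalWait (hN : IsPoissonProcess P ℱ N) {i : ℕ}
    (hi : IsStoppingTime ℱ (renewalTime g N i)) :
    Measurable[(hN.isStoppingTime_nextArrival hi).measurableSpace] (renewalWait g N i) := by
  have h2 := measurable_mono_stoppingTime hi (hN.isStoppingTime_nextArrival hi)
    (fun ω => le_self_add) (measurable_stoppingTime hi)
  exact (measurable_stoppingTime (hN.isStoppingTime_nextArrival hi)).sub h2

/-- The cycle is cut at its first arrival, itself a stopping time, when the remainder of the cycle
length is already known. -/
theorem IsPoissonProcess.isStoppingTime_renewalTime (hN : IsPoissonProcess P ℱ N)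
    (hg : Measurable g) (i : ℕ) : IsStoppingTime ℱ (renewalTime g N i) := by
  induction i with
  | zero => exact isStoppingTime_const ℱ 0
  | succ i ih =>
    have h1 := hN.measurable_renewalWait ih
    have h2 : Measurable fun x : ℝ≥0∞ => ((g x.toNNReal - x.toNNReal : ℝ≥0) : ℝ≥0∞) :=
      ((hg.comp ENNReal.measurable_toNNReal).sub ENNReal.measurable_toNNReal).coe_nnreal_ennreal
    exact isStoppingTime_add (hN.isStoppingTime_nextArrival ih) (h2.comp h1)

theorem IsPoissonProcess.measurable_renewalWait_succ (hN : IsPoissonProcess P ℱ N)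
    (hg : Measurable g) (i : ℕ) :
    Measurable[(hN.isStoppingTime_renewalTime hg (i + 1)).measurableSpace] (renewalWait g N i) :=
  measurable_mono_stoppingTime
    (hN.isStoppingTime_nextArrival (hN.isStoppingTime_renewalTime hg i))
    (hN.isStoppingTime_renewalTime hg (i + 1)) (fun _ => le_self_add)
    (hN.measurable_renewalWait (hN.isStoppingTime_renewalTime hg i))

theorem IsPoissonProcess.ae_renewalTime_ne_top [IsProbabilityMeasure P]
    (hN : IsPoissonProcess P ℱ N) (hg : Measurable g) :
    ∀ᵐ ω ∂P, ∀ i, renewalTime g N i ω ≠ ∞ := by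
  rw [ae_all_iff]
  intro i
  induction i with
  | zero => exact ae_of_all _ fun ω => ENNReal.zero_ne_top
  | succ i ih =>
    filter_upwards [ih, hN.ae_timeToArrival_ne_top_of_ae (hN.isStoppingTime_renewalTime hg i) ih]
      with ω h1 h2
    rw [renewalTime_succ]
    exact ENNReal.add_ne_top.2 ⟨ENNReal.add_ne_top.2 ⟨h1, h2⟩, ENNReal.coe_ne_top⟩

theorem IsPoissonProcess.measure_inter_renewalWait_mem [IsProbabilityMeasure P]
    (hN : IsPoissonProcess P ℱ N) (hg : Measurable g) {i : ℕ} {A : Set Ω}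
    (hA : MeasurableSet[(hN.isStoppingTime_renewalTime hg i).measurableSpace] A) {S : Set ℝ}
    (hS : MeasurableSet S) :
    P (A ∩ {ω | (renewalWait g N i ω).toReal ∈ S}) = P A * expMeasure 1 S := by
  have hi := hN.isStoppingTime_renewalTime hg i
  have hfin := (ae_all_iff.1 (hN.ae_renewalTime_ne_top hg)) i
  have h := hN.measure_inter_timeToArrival_mem hi
    (MeasurableSet.inter hA (measurable_stoppingTime hi (measurableSet_singleton ∞).compl))
    (fun ω hω => hω.2) hS
  have e1 : (A ∩ renewalTime g N i ⁻¹' {∞}ᶜ : Set Ω) =ᵐ[P] A := by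
    filter_upwards [hfin] with ω hω
    exact propext ⟨fun h => h.1, fun h => ⟨h, hω⟩⟩
  have e2 : (A ∩ renewalTime g N i ⁻¹' {∞}ᶜ
        ∩ {ω | (timeToArrival N (renewalTime g N i ω) ω).toReal ∈ S} : Set Ω)
      =ᵐ[P] (A ∩ {ω | (renewalWait g N i ω).toReal ∈ S} : Set Ω) := by
    filter_upwards [hfin] with ω hω
    have : renewalWait g N i ω = timeToArrival N (renewalTime g N i ω) ω :=
      ENNReal.add_sub_cancel_left hω
    refine propext ⟨fun h => ⟨h.1.1, ?_⟩, fun h => ⟨⟨h.1, hω⟩, ?_⟩⟩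
    · change (renewalWait g N i ω).toReal ∈ S
      rw [this]
      exact h.2
    · change (timeToArrival N (renewalTime g N i ω) ω).toReal ∈ S
      rw [← this]
      exact h.2
  rwa [measure_congr e2, measure_congr e1] at h

/-- Induction on cycles: the earlier waits are known at the `n`-th renewal time, and the `n`-th wait
is independent of that past. Carrying the measurability along is what lets the strong Markov
property apply. -/
theorem IsPoissonProcess.measure_iInter_renewalWait_mem [IsProbabilityMeasure P]
    (hN : IsPoissonProcess P ℱ N) (hg : Measurable g) {S : ℕ → Set ℝ}
    (hS : ∀ i, MeasurableSet (S i)) (n : ℕ) :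
    MeasurableSet[(hN.isStoppingTime_renewalTime hg n).measurableSpace]
        {ω | ∀ i < n, (renewalWait g N i ω).toReal ∈ S i} ∧
      P {ω | ∀ i < n, (renewalWait g N i ω).toReal ∈ S i}
        = ∏ i ∈ Finset.range n, expMeasure 1 (S i) := by
  induction n with
  | zero => simp
  | succ n ih =>
    have e : {ω | ∀ i < n + 1, (renewalWait g N i ω).toReal ∈ S i}
        = {ω | ∀ i < n, (renewalWait g N i ω).toReal ∈ S i}
          ∩ {ω | (renewalWait g N n ω).toReal ∈ S n} := by
      ext ω
      exact Nat.forall_lt_succ_right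
    rw [e]
    constructor
    · refine MeasurableSet.inter ?_ ?_
      · refine IsStoppingTime.measurableSpace_mono (hN.isStoppingTime_renewalTime hg n)
          (hN.isStoppingTime_renewalTime hg (n + 1)) (renewalTime_step n) _ ih.1
      · exact (hN.measurable_renewalWait_succ hg n).ennreal_toReal (hS n)
    · rw [hN.measure_inter_renewalWait_mem hg ih.1 (hS n), ih.2, Finset.prod_range_succ]

theorem IsPoissonProcess.measurable_renewalWait_toReal (hN : IsPoissonProcess P ℱ N)
    (hg : Measurable g) (i : ℕ) : Measurable fun ω => (renewalWait g N i ω).toReal :=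
  ((hN.measurable_renewalWait_succ hg i).mono
    (hN.isStoppingTime_renewalTime hg (i + 1)).measurableSpace_le le_rfl).ennreal_toReal

theorem IsPoissonProcess.map_renewalWait [IsProbabilityMeasure P] (hN : IsPoissonProcess P ℱ N)
    (hg : Measurable g) (i : ℕ) :
    P.map (fun ω => (renewalWait g N i ω).toReal) = expMeasure 1 := by
  ext S hS
  rw [Measure.map_apply (hN.measurable_renewalWait_toReal hg i) hS]
  have := hN.measure_inter_renewalWait_mem hg (i := i) MeasurableSet.univ hS
  rwa [Set.univ_inter, measure_univ, one_mul] at this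

theorem IsPoissonProcess.iIndepFun_renewalWait [IsProbabilityMeasure P]
    (hN : IsPoissonProcess P ℱ N) (hg : Measurable g) :
    iIndepFun (fun i ω => (renewalWait g N i ω).toReal) P := by
  classical
  rw [iIndepFun_iff_measure_inter_preimage_eq_mul]
  intro I S hS
  have := isProbabilityMeasure_expMeasure (r := 1) one_pos
  -- Indices outside `I` are padded with the whole line, which turns `I` into an initial segment and
  -- contributes factors `1`.
  set S' : ℕ → Set ℝ := fun i => if i ∈ I then S i else Set.univ with hS'
  have hS'm : ∀ i, MeasurableSet (S' i) := by
    intro i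
    simp only [hS']
    split_ifs with h
    · exact hS i h
    · exact MeasurableSet.univ
  have hI : I ⊆ Finset.range (I.sup id + 1) := fun i hi =>
    Finset.mem_range.2 (Nat.lt_succ_of_le (Finset.le_sup (f := id) hi))
  have e1 : (⋂ i ∈ I, (fun ω => (renewalWait g N i ω).toReal) ⁻¹' S i)
      = {ω | ∀ i < I.sup id + 1, (renewalWait g N i ω).toReal ∈ S' i} := by
    ext ω
    simp only [Set.mem_iInter, Set.mem_preimage, Set.mem_ofPred_eq]
    constructor
    · intro h i _
      simp only [hS']
      split_ifs with hi
      · exact h i hi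
      · trivial
    · intro h i hi
      have := h i (Finset.mem_range.1 (hI hi))
      simpa only [hS', if_pos hi] using this
  rw [e1, (hN.measure_iInter_renewalWait_mem hg hS'm _).2, ← Finset.prod_subset hI]
  · refine Finset.prod_congr rfl fun i hi => ?_
    rw [← hN.map_renewalWait hg i,
      Measure.map_apply (hN.measurable_renewalWait_toReal hg i) (hS'm i)]
    simp only [hS', if_pos hi]
  · intro i _ hi
    simp only [hS', if_neg hi, measure_univ]

/-- An epoch start is an update with a random index, so its stopping property is not immediate;
identifying it with the explicit model transfers the law of the waits to the epochs. -/
theorem IsPoissonProcess.ae_epochStart_eq [IsProbabilityMeasure P] (hN : IsPoissonProcess P ℱ N)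
    (hk : 1 ≤ k) :
    ∀ᵐ ω ∂P, ∀ i, epochStart k N (thresholdPolicy k l N) i ω = renewalTime (epochLength k l) N i ω ∧
      epochStart k N (thresholdPolicy k l N) (i + 1) ω
          - epochStart k N (thresholdPolicy k l N) i ω
        = epochLength k l (renewalWait (epochLength k l) N i ω).toReal.toNNReal := by
  filter_upwards [hN.ae_isRegularPath (k := k) (l := l)] with ω hω
  have hfin : ∀ i, epochStart k N (thresholdPolicy k l N) i ω ≠ ∞ := fun i => hω.finite _
  have hwait : ∀ i, epochStart k N (thresholdPolicy k l N) i ω = renewalTime (epochLength k l) N i ω →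
      renewalWait (epochLength k l) N i ω
        = timeToArrival N (epochStart k N (thresholdPolicy k l N) i ω) ω := by
    intro i hi
    rw [renewalWait, ← hi, ENNReal.add_sub_cancel_left (hfin i)]
  have heq : ∀ i, epochStart k N (thresholdPolicy k l N) i ω
      = renewalTime (epochLength k l) N i ω := by
    intro i
    induction i with
    | zero => exact epochStart_zero ω
    | succ i ih =>
      rw [hN.epochStart_succ hω hk, renewalTime_succ, hwait i ih, ← ih, add_assoc]
      have hf : timeToArrival N (epochStart k N (thresholdPolicy k l N) i ω) ω ≠ ∞ := hω.arrival _
      congr 1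
      conv_rhs => rw [← ENNReal.coe_toNNReal hf]
      rw [← ENNReal.coe_add]
      congr 1
      -- The truncated subtraction in `renewalTime` is exact because an epoch lasts at least until
      -- its first arrival.
      exact (add_tsub_cancel_of_le (le_max_left _ _)).symm
  refine fun i => ⟨heq i, ?_⟩
  rw [hN.epochStart_succ hω hk, ENNReal.add_sub_cancel_left (hfin i), hwait i (heq i)]
  rw [← ENNReal.coe_toNNReal_eq_toReal, Real.toNNReal_coe]

/-- The starts of the epochs of the threshold policy form a renewal process. -/
theorem IsPoissonProcess.isRenewalProcess_thresholdPolicy [IsProbabilityMeasure P]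
    (hN : IsPoissonProcess P ℱ N) (hk : 1 ≤ k) (hl : 0 < l) :
    IsRenewalProcess P (epochStart k N (thresholdPolicy k l N)) := by
  have hg := measurable_epochLength k l
  set φ : ℝ → ℝ≥0∞ := fun x => epochLength k l x.toNNReal with hφ
  have hφm : Measurable φ := (hg.comp measurable_real_toNNReal).coe_nnreal_ennreal
  have hinc : ∀ i, (fun ω => epochStart k N (thresholdPolicy k l N) (i + 1) ω
      - epochStart k N (thresholdPolicy k l N) i ω)
      =ᵐ[P] fun ω => φ (renewalWait (epochLength k l) N i ω).toReal := by
    intro i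
    filter_upwards [hN.ae_epochStart_eq (l := l) hk] with ω hω
    exact (hω i).2
  have hU := fun i => hN.measurable_renewalWait_toReal hg i
  have hident : ∀ i, IdentDistrib (fun ω => φ (renewalWait (epochLength k l) N i ω).toReal)
      (fun ω => φ (renewalWait (epochLength k l) N 0 ω).toReal) P P := by
    intro i
    have : IdentDistrib (fun ω => (renewalWait (epochLength k l) N i ω).toReal)
        (fun ω => (renewalWait (epochLength k l) N 0 ω).toReal) P P :=
      ⟨(hU i).aemeasurable, (hU 0).aemeasurable, by
        rw [hN.map_renewalWait hg, hN.map_renewalWait hg]⟩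
    exact this.comp hφm
  refine ⟨ae_of_all _ epochStart_zero, ?_, ?_, ?_, ?_, ?_⟩
  · filter_upwards [hN.ae_isRegularPath (k := k) (l := l)] with ω hω
    exact monotone_nat_of_le_succ fun i => by
      rw [hN.epochStart_succ hω hk]
      exact le_self_add
  · filter_upwards [hN.ae_isRegularPath (k := k) (l := l)] with ω hω i
    exact hω.finite _
  · intro h
    obtain ⟨ω, h1, h2⟩ := (h.and (hinc 0)).exists
    simp only at h2
    rw [h1] at h2
    have : epochLength k l (renewalWait (epochLength k l) N 0 ω).toReal.toNNReal = 0 := by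
      exact ENNReal.coe_eq_zero.1 h2.symm
    have h3 : l ≤ 0 := by
      rw [← this]
      exact le_self_add.trans (le_max_right _ _)
    exact absurd hl (not_lt.2 h3)
  · rw [iIndepFun_congr hinc]
    exact (hN.iIndepFun_renewalWait hg).comp (fun _ => φ) fun _ => hφm
  · intro i
    have h1 := IdentDistrib.of_ae_eq ((hφm.comp (hU i)).aemeasurable.congr (hinc i).symm) (hinc i)
    have h2 := IdentDistrib.of_ae_eq ((hφm.comp (hU 0)).aemeasurable.congr (hinc 0).symm) (hinc 0)
    exact (h1.trans (hident i)).trans h2.symm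

end Renewal

end AgeOfInformation

/-! ### The main theorem. -/

theorem theorem1 (k : ℕ) (hk : 2 ≤ k) :
    ∃ (c : ℕ → ℝ≥0) (g : ℝ≥0 → ℝ≥0),
      (∀ j, 1 ≤ j → j + 1 ≤ k - 1 → c (j + 1) ≤ c j) ∧
      Measurable g ∧ (∀ t, t ≤ g t) ∧
      ∀ (Ω : Type u) [MeasurableSpace Ω] (P : Measure Ω) [IsProbabilityMeasure P]
        (ℱ : Filtration ℝ≥0 ‹MeasurableSpace Ω›) (N : ℝ≥0 → Ω → ℕ),
        AgeOfInformation.IsPoissonProcess P ℱ N →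
        ∃ s : ℕ → Ω → ℝ≥0∞,
          AgeOfInformation.IsAdmissible P ℱ k N s ∧
          (∀ s' : ℕ → Ω → ℝ≥0∞, AgeOfInformation.IsAdmissible P ℱ k N s' →
            AgeOfInformation.averageAge P s ≤ AgeOfInformation.averageAge P s') ∧
          AgeOfInformation.IsRenewalProcess P (AgeOfInformation.epochStart k N s) ∧
          AgeOfInformation.HasConstantOffsets P k N s c g := by
  obtain ⟨l, hl⟩ := AgeOfInformation.exists_isCriticalRate k
  have hk1 : 1 ≤ k := by omega
  refine ⟨fun j => AgeOfInformation.offset k l (k - j), AgeOfInformation.epochLength k l,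
    fun j _ _ => AgeOfInformation.offset_mono k l (by omega),
    AgeOfInformation.measurable_epochLength k l, fun t => le_max_left _ _, ?_⟩
  intro Ω _ P _ ℱ N hN
  exact ⟨AgeOfInformation.thresholdPolicy k l N, hN.isAdmissible_thresholdPolicy hk1,
    fun s' hs' => (hN.averageAge_thresholdPolicy_le hk1 hl).trans
      (AgeOfInformation.le_averageAge hN hl hs'),
    hN.isRenewalProcess_thresholdPolicy hk1 hl.pos, hN.hasConstantOffsets_thresholdPolicy hk1⟩
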